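/- Let $\Bbbk$ be an algebraically closed field, let $n\ge 1$, and let $Q$ be a quiver of type $\mathbb{A}_n$: its vertex set is $Q_0=\{1,\dots,n\}$, for each $1\le i<n$ there is exactly one arrow between $i$ and $i+1$ (either $i\to i+1$ or $i+1\to i$), and there are no other arrows. Representations of $Q$ are finite-dimensional over $\Bbbk$, and $K_0(Q)$ is identified with $\mathbb{Z}^{Q_0}$ through dimension vectors. A (linear) stability condition is a group homomorphism $Z\colon K_0(Q)\to\mathbb{C}$ with $\operatorname{Im} Z(M)>0$ for every nonzero representation $M$; equivalently, $Z(x)=w\cdot x+(r\cdot x)\,i$ with $(w,r)\in\mathbb{R}^{Q_0}\times(\mathbb{R}_{>0})^{Q_0}$. Its slope function is $\mu_Z(x)=\operatorname{Re}Z(x)/\operatorname{Im}Z(x)=\frac{w\cdot x}{r\cdot x}$. A representation $V$ is $Z$-stable if $\mu_Z(W)<\mu_Z(V)$ for every nonzero proper subrepresentation $W\subset V$. Let $\mathcal{TS}(Q)$ be the set of stability conditions $Z$ such that every indecomposable representation of $Q$ is $Z$-stable, regarded as a subset of $\mathbb{R}^{Q_0}\times(\mathbb{R}_{>0})^{Q_0}$.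 Define $x,y\colon Q_0\to\mathbb{Z}_{\ge 0}$ by $x(1)=y(1)=0$ and, for $1\le i<n$, $(x(i+1),y(i+1))=(x(i)+1,\,y(i))$ if there is an arrow $i\to i+1$, and $(x(i+1),y(i+1))=(x(i),\,y(i)+1)$ if there is an arrow $i+1\to i$. Put $X_k=\{z\in Q_0: x(z)=k\}$ for $0\le k\le x(n)$ and $Y_k=\{z\in Q_0: y(z)=k\}$ for $0\le k\le y(n)$. For $S\subseteq Q_0$ let $[S]$ be the representation with $\Bbbk$ at the vertices in $S$ and $0$ at the other vertices, the identity map over every arrow with both ends in $S$, and the zero map over every other arrow. Then $x(n)+y(n)=n-1$, and a stability condition $Z$ belongs to $\mathcal{TS}(Q)$ if and only if the $n-1$ inequalities $$\mu_Z([X_0])>\mu_Z([X_1])>\cdots>\mu_Z([X_{x(n)}]),\qquad \mu_Z([Y_0])<\mu_Z([Y_1])<\cdots<\mu_Z([Y_{y(n)}])$$ hold. Furthermore, $\mathcal{TS}(Q)$ is open in $\mathbb{R}^{Q_0}\times(\mathbb{R}_{>0})^{Q_0}$, and these $n-1$ inequalities between consecutive terms are a minimal set of inequalities defining it: the subset of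 $\mathbb{R}^{Q_0}\times(\mathbb{R}_{>0})^{Q_0}$ defined by any proper subset of them is different from $\mathcal{TS}(Q)$. -/

import Mathlib

universe u v w

noncomputable section

/-- A finite-dimensional representation over the field `k` of the quiver with vertex type `V`. -/
structure QuiverRep (k : Type u) [Field k] (V : Type v) [Quiver.{w} V] where
  /-- the vector space at a vertex -/
  space : V → Type u
  [addCommGroup : ∀ z, AddCommGroup (space z)]
  [module : ∀ z, Module k (space z)]
  [finiteDimensional : ∀ z, FiniteDimensional k (space z)]
  /-- the linear map over an arrow -/
  map : ∀ {a b : V}, (a ⟶ b) → (space a →ₗ[k] space b)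

namespace QuiverRep

attribute [instance] QuiverRep.addCommGroup QuiverRep.module QuiverRep.finiteDimensional

variable {k : Type u} [Field k] {V : Type v} [Quiver.{w} V]

/-- A representation is nonzero if some vertex carries a nonzero vector space. -/
def IsNonzero (M : QuiverRep k V) : Prop := ∃ z, Nontrivial (M.space z)

/-- The dimension vector, i.e. the class of `M` in the Grothendieck group `K₀(Q) = ℤ^{Q₀}`, in
the basis of the classes of the simple representations at the vertices. -/
def dimVec (M : QuiverRep k V) : V → ℤ := fun z => (Module.finrank k (M.space z) : ℤ)

/-- A subrepresentation: a choice of subspaces that the maps of the representation preserve. -/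
structure Subrep (M : QuiverRep k V) where
  /-- the subspace at a vertex -/
  space : ∀ z, Submodule k (M.space z)
  map_mem : ∀ {a b : V} (α : a ⟶ b) (x : M.space a), x ∈ space a → M.map α x ∈ space b

namespace Subrep

variable {M : QuiverRep k V}

/-- A subrepresentation, regarded as a representation in its own right. -/
def toRep (N : Subrep M) : QuiverRep k V where
  space z := N.space z
  map {a b} α := (M.map α).restrict (p := N.space a) (q := N.space b) (N.map_mem α)

/-- The subrepresentation is zero. -/
def IsZero (N : Subrep M) : Prop := ∀ z, N.space z = ⊥

/-- The subrepresentation is the whole representation. -/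
def IsWhole (N : Subrep M) : Prop := ∀ z, N.space z = ⊤

end Subrep

/-- `M` is indecomposable: it is nonzero, and in every decomposition of `M` as an (internal)
direct sum of two subrepresentations one of the two is zero. -/
def IsIndecomposable (M : QuiverRep k V) : Prop :=
  M.IsNonzero ∧
    ∀ N N' : Subrep M, (∀ z, IsCompl (N.space z) (N'.space z)) → N.IsZero ∨ N'.IsZero

open Classical in
/-- The representation `[S]` attached to a set `S` of vertices: the field `k` at the vertices in
`S` and `0` at the others (realised as the subspaces `⊤` and `⊥` of `k`), with the identity of `k`
over the arrows that have both ends in `S`, and `0` over all other arrows. -/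
def ofSet (k : Type u) [Field k] {V : Type v} [Quiver.{w} V] (S : Set V) : QuiverRep k V where
  space z := ((if z ∈ S then ⊤ else ⊥ : Submodule k k))
  map {a b} _ :=
    if h : a ∈ S ∧ b ∈ S then
      Submodule.inclusion (by rw [if_pos h.1, if_pos h.2])
    else 0

end QuiverRep

section Stability

/-- The slope `μ_Z(x) = Re Z(x) / Im Z(x)` of a class `x ∈ K₀(Q) = ℤ^{Q₀}`. -/
def slopeOf {V : Type v} (Z : (V → ℤ) →+ ℂ) (x : V → ℤ) : ℝ := (Z x).re / (Z x).im

/-- `Z : K₀(Q) → ℂ` is a linear stability condition (central charge): the class of every nonzero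
representation is sent to a complex number with positive imaginary part. -/
def IsCentralCharge (k : Type u) [Field k] {V : Type v} [Quiver.{w} V]
    (Z : (V → ℤ) →+ ℂ) : Prop :=
  ∀ M : QuiverRep k V, M.IsNonzero → 0 < (Z M.dimVec).im

/-- `M` is `Z`-stable: every nonzero proper subrepresentation has smaller slope. -/
def QuiverRep.IsStable {k : Type u} [Field k] {V : Type v} [Quiver.{w} V]
    (Z : (V → ℤ) →+ ℂ) (M : QuiverRep k V) : Prop :=
  ∀ N : QuiverRep.Subrep M, ¬ N.IsZero → ¬ N.IsWhole →
    slopeOf Z N.toRep.dimVec < slopeOf Z M.dimVec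

/-- The set `TS(Q)` of total stability conditions: the linear stability conditions for which every
indecomposable representation is stable. -/
def TotalStability (k : Type u) [Field k] (V : Type v) [Quiver.{w} V] :
    Set ((V → ℤ) →+ ℂ) :=
  {Z | IsCentralCharge k Z ∧ ∀ M : QuiverRep k V, M.IsIndecomposable → M.IsStable Z}

/-- The homomorphism `Z(x) = w ⬝ x + (r ⬝ x) i` with coordinates `p = (w, r)`. -/
def ofCoords {V : Type v} [Fintype V] (p : (V → ℝ) × (V → ℝ)) : (V → ℤ) →+ ℂ where
  toFun x := ⟨∑ z, p.1 z * (x z : ℝ), ∑ z, p.2 z * (x z : ℝ)⟩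
  map_zero' := by
    apply Complex.ext <;> simp
  map_add' x y := by
    apply Complex.ext <;> simp [mul_add, Finset.sum_add_distrib]

end Stability

section TypeA

variable {V : Type v} [Quiver.{w} V] {m : ℕ}

/-- The quiver on `V` is of type `𝔸ₙ`, `n = m + 1`, with its vertices labelled `e 0, …, e m` along
the line: there is exactly one arrow (in one of the two directions) between consecutive vertices,
and there are no other arrows. -/
structure IsTypeA (e : Fin (m + 1) ≃ V) : Prop where
  card_arrows : ∀ i : Fin m,
    Nat.card ((e i.castSucc ⟶ e i.succ) ⊕ (e i.succ ⟶ e i.castSucc)) = 1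
  no_arrow : ∀ i j : Fin (m + 1), (i : ℕ) + 1 ≠ j → (j : ℕ) + 1 ≠ i → IsEmpty (e i ⟶ e j)

open Classical in
/-- The `x`-coordinate of the `i`-th vertex: it starts at `0` and grows by one along each arrow
that points from a vertex to the next one. -/
def xCoord (e : Fin (m + 1) ≃ V) (i : Fin (m + 1)) : ℕ :=
  Fin.induction (motive := fun _ => ℕ) 0
    (fun j x => if Nonempty (e j.castSucc ⟶ e j.succ) then x + 1 else x) i

open Classical in
/-- The `y`-coordinate of the `i`-th vertex: it starts at `0` and grows by one along each arrow
that points from a vertex to the previous one. -/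
def yCoord (e : Fin (m + 1) ≃ V) (i : Fin (m + 1)) : ℕ :=
  Fin.induction (motive := fun _ => ℕ) 0
    (fun j y => if Nonempty (e j.succ ⟶ e j.castSucc) then y + 1 else y) i

/-- The column `X_c`: the vertices with `x`-coordinate `c`. -/
def colSet (e : Fin (m + 1) ≃ V) (c : ℕ) : Set V := {z | xCoord e (e.symm z) = c}

/-- The row `Y_c`: the vertices with `y`-coordinate `c`. -/
def rowSet (e : Fin (m + 1) ≃ V) (c : ℕ) : Set V := {z | yCoord e (e.symm z) = c}

/-- The inequality `μ_Z([X_c]) > μ_Z([X_{c+1}])`. -/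
def ColIneq (k : Type u) [Field k] (e : Fin (m + 1) ≃ V) (Z : (V → ℤ) →+ ℂ) (c : ℕ) : Prop :=
  slopeOf Z (QuiverRep.ofSet k (colSet e c)).dimVec >
    slopeOf Z (QuiverRep.ofSet k (colSet e (c + 1))).dimVec

/-- The inequality `μ_Z([Y_c]) < μ_Z([Y_{c+1}])`. -/
def RowIneq (k : Type u) [Field k] (e : Fin (m + 1) ≃ V) (Z : (V → ℤ) →+ ℂ) (c : ℕ) : Prop :=
  slopeOf Z (QuiverRep.ofSet k (rowSet e c)).dimVec <
    slopeOf Z (QuiverRep.ofSet k (rowSet e (c + 1))).dimVec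

end TypeA

end

noncomputable section

/-! ### Convexity of the path of partial sums. -/

section Numerics

open Finset

/-! Number the vertices along the line and let P(t) be the plane point with coordinates ∑_{i<t} r_i
and ∑_{i<t} w_i. The slope of the interval module on [a, b] is the slope of the chord from P(a) to
P(b+1). A column ends where an arrow points to the next vertex, a row where it points back, so each
interior point of the path is a column break or a row break, never both. The inequalities say that
the polygon through the two ends and the column breaks is strictly concave, and the one through the
two ends and the row breaks strictly convex.

Sufficiency: the convex polygon stays below the chord of the whole path, so each column break has a
line through it that lies strictly above the rest of the path (`exists_supporting_slope`). It is
therefore strictly above every chord that spans it (`chord_pos`); under w ↦ -w, row breaks are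
strictly below. Indecomposables are interval modules with injective maps (`exists_interval`, by
splitting off strings), so the dimensions of a subrepresentation do not drop along arrows inside the
interval. Summation by parts then reduces stability to these chord inequalities
(`slope_lt_of_closed`).

Necessity: two consecutive columns form an interval whose module has [X_{c+1}] as a
subrepresentation; for rows it is [Y_c]. Comparing with the quotient gives the inequality.
Minimality: the heights of the interior points are independent, so all column and row slopes can be
prescribed up to a common shift in each family (`exists_weights`), and any one inequality can be
made an equality while the others hold. -/

/-- The sum of `f` over the vertices `j ≤ m` that are preceded by exactly `c` turns. -/
def levelSum (U : ℕ → Prop) [DecidablePred U] (m : ℕ) (f : ℕ → ℝ) (c : ℕ) : ℝ :=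
  ∑ j ∈ range (m + 1) with Nat.count U j = c, f j

section Levels

variable {U : ℕ → Prop} [DecidablePred U] {m : ℕ}

theorem exists_count_eq (U : ℕ → Prop) [DecidablePred U] (m : ℕ) :
    ∀ c ≤ Nat.count U m, ∃ j ≤ m, Nat.count U j = c := by
  induction m with
  | zero => intro c hc; exact ⟨0, le_rfl, by simp at hc ⊢; omega⟩
  | succ m ih =>
    intro c hc
    by_cases h : c ≤ Nat.count U m
    · obtain ⟨j, hj, rfl⟩ := ih c h
      exact ⟨j, by omega, rfl⟩
    · refine ⟨m + 1, le_rfl, ?_⟩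
      rw [Nat.count_succ] at hc ⊢
      split_ifs at hc ⊢ <;> omega

theorem levelSum_pos {r : ℕ → ℝ} (hr : ∀ j ≤ m, 0 < r j) {c : ℕ} (hc : c ≤ Nat.count U m) :
    0 < levelSum U m r c := by
  obtain ⟨j, hj, rfl⟩ := exists_count_eq U m c hc
  apply sum_pos
  · intro i hi
    simp only [mem_filter, mem_range] at hi
    exact hr i (by omega)
  · exact ⟨j, by simp; omega⟩

theorem levelSum_sub_mul (w r : ℕ → ℝ) (l : ℝ) (c : ℕ) :
    levelSum U m (fun j => w j - l * r j) c = levelSum U m w c - l * levelSum U m r c := by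
  simp only [levelSum, sum_sub_distrib, mul_sum]

theorem sum_range_levelSum (f : ℕ → ℝ) (q : ℕ) :
    ∑ c ∈ range q, levelSum U m f c = ∑ j ∈ range (m + 1) with Nat.count U j < q, f j := by
  rw [← sum_fiberwise_of_maps_to (s := {j ∈ range (m + 1) | Nat.count U j < q}) (t := range q)
    (g := Nat.count U) (fun i hi => by simpa using (mem_filter.1 hi).2)]
  apply sum_congr rfl
  intro c hc
  rw [levelSum, filter_filter]
  apply sum_congr _ fun _ _ => rfl
  ext j
  simp only [mem_filter, mem_range] at hc ⊢
  grind

/-- At a turn the partial sums are sums over full levels. -/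
theorem sum_range_of_turn (f : ℕ → ℝ) {j : ℕ} (hj : j < m) (hU : U j) :
    ∑ i ∈ range (j + 1), f i = ∑ c ∈ range (Nat.count U j + 1), levelSum U m f c := by
  rw [sum_range_levelSum]
  apply sum_congr _ fun _ _ => rfl
  ext i
  simp only [mem_filter, mem_range]
  constructor
  · intro h
    have := Nat.count_monotone U (show i ≤ j by omega)
    omega
  · rintro ⟨_, h⟩
    by_contra hlt
    have h1 := Nat.count_monotone U (show j + 1 ≤ i by omega)
    rw [Nat.count_succ, if_pos hU] at h1
    omega

theorem sum_range_eq_sum_levels (f : ℕ → ℝ) :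
    ∑ i ∈ range (m + 1), f i = ∑ c ∈ range (Nat.count U m + 1), levelSum U m f c := by
  rw [sum_range_levelSum]
  apply sum_congr _ fun _ _ => rfl
  ext i
  simp only [mem_filter, mem_range]
  constructor
  · intro h
    have := Nat.count_monotone U (show i ≤ m by omega)
    omega
  · exact fun h => h.1

end Levels

/-- The slopes of the levels of `U` strictly decrease. -/
def LevelsDecrease (U : ℕ → Prop) [DecidablePred U] (m : ℕ) (w r : ℕ → ℝ) : Prop :=
  ∀ c < Nat.count U m,
    levelSum U m w (c + 1) / levelSum U m r (c + 1) < levelSum U m w c / levelSum U m r c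

theorem sum_range_lt_peak {A : ℕ → ℝ} {q N : ℕ} (hpos : ∀ c < q, 0 < A c)
    (hneg : ∀ c, q ≤ c → c < N → A c < 0) {t : ℕ} (ht : t ≤ N) (hne : t ≠ q) :
    ∑ c ∈ range t, A c < ∑ c ∈ range q, A c := by
  rcases lt_or_gt_of_ne hne with h | h
  · rw [← sum_range_add_sum_Ico A h.le, lt_add_iff_pos_right]
    exact sum_pos (fun i hi => hpos i (mem_Ico.1 hi).2) (nonempty_Ico.2 h)
  · rw [← sum_range_add_sum_Ico A h.le, add_lt_iff_neg_left]
    exact sum_neg (fun i hi => hneg i (mem_Ico.1 hi).1 (by have := (mem_Ico.1 hi).2; omega))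
      (nonempty_Ico.2 h)

/-- The terms are nonpositive up to some index and positive afterwards, so the partial sums first
fall and then rise, as heights along a convex polygon do. -/
theorem sum_range_le_max_ends {A : ℕ → ℝ} {N : ℕ}
    (hA : ∀ i j, i ≤ j → j < N → A j ≤ 0 → A i ≤ 0) {t : ℕ} (ht : t ≤ N) :
    ∑ c ∈ range t, A c ≤ max 0 (∑ c ∈ range N, A c) := by
  by_cases h : ∀ i < t, A i ≤ 0
  · exact le_max_of_le_left (sum_nonpos fun i hi => h i (mem_range.1 hi))
  · push Not at h
    obtain ⟨i, hi, hpos⟩ := h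
    apply le_max_of_le_right
    rw [← sum_range_add_sum_Ico A ht, le_add_iff_nonneg_right]
    apply sum_nonneg
    intro j hj
    rw [mem_Ico] at hj
    by_contra hneg
    exact absurd (hA i j (by omega) hj.2 (by linarith)) (by linarith)

theorem antitone_slopes_of_step {μ : ℕ → ℝ} {N : ℕ} (h : ∀ c < N, μ (c + 1) < μ c) {i j : ℕ}
    (hij : i ≤ j) (hj : j ≤ N) : μ j ≤ μ i := by
  induction j, hij using Nat.le_induction with
  | base => rfl
  | succ j hij ih => exact (h j (by omega)).le.trans (ih (by omega))

section Chord

variable {U : ℕ → Prop} [DecidablePred U] {m : ℕ} {w r : ℕ → ℝ}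

/-- If the levels of `U` have decreasing slopes and those of the complement increasing slopes,
then at every turn of `U` there is a line that touches the path of partial sums exactly there. -/
theorem exists_supporting_slope (hr : ∀ j ≤ m, 0 < r j) (hU : LevelsDecrease U m w r)
    (hU' : LevelsDecrease (fun j => ¬ U j) m (fun j => -w j) r) {j : ℕ} (hj : j < m) (hUj : U j) :
    ∃ l : ℝ, ∀ t ≤ m + 1, t ≠ j + 1 →
      ∑ i ∈ range t, (w i - l * r i) < ∑ i ∈ range (j + 1), (w i - l * r i) := by
  have hcj : Nat.count U j < Nat.count U m := by
    have h1 := Nat.count_monotone U (show j + 1 ≤ m by omega)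
    rw [Nat.count_succ, if_pos hUj] at h1
    omega
  -- The supporting line gets a slope strictly between those of the level ending at `j` and of the
  -- next one; after subtracting `l * r`, levels are positive up to this turn and negative after it.
  obtain ⟨l, hl1, hl2⟩ := exists_between (hU _ hcj)
  refine ⟨l, ?_⟩
  set f : ℕ → ℝ := fun i => w i - l * r i with hf
  have hpos : ∀ c < Nat.count U j + 1, 0 < levelSum U m f c := by
    intro c hc
    have h1 := levelSum_pos (U := U) hr (c := c) (by omega)
    have h2 := antitone_slopes_of_step (μ := fun c => levelSum U m w c / levelSum U m r c) hU
      (show c ≤ Nat.count U j by omega) (by omega)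
    rw [levelSum_sub_mul]
    have h3 := (lt_div_iff₀ h1).1 (hl2.trans_le h2)
    linarith
  have hneg : ∀ c, Nat.count U j + 1 ≤ c → c < Nat.count U m + 1 → levelSum U m f c < 0 := by
    intro c hc hc'
    have h1 := levelSum_pos (U := U) hr (c := c) (by omega)
    have h2 := antitone_slopes_of_step (μ := fun c => levelSum U m w c / levelSum U m r c) hU
      hc (by omega)
    rw [levelSum_sub_mul]
    have h3 := (div_lt_iff₀ h1).1 (h2.trans_lt hl1)
    linarith
  have hpeak : ∀ q ≤ Nat.count U m + 1, q ≠ Nat.count U j + 1 →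
      ∑ c ∈ range q, levelSum U m f c < ∑ i ∈ range (j + 1), f i := by
    intro q hq hne
    rw [sum_range_of_turn f hj hUj]
    exact sum_range_lt_peak hpos hneg hq hne
  have h0 : 0 < ∑ i ∈ range (j + 1), f i := by
    simpa using hpeak 0 (by omega) (by omega)
  have hend : ∑ i ∈ range (m + 1), f i < ∑ i ∈ range (j + 1), f i := by
    rw [sum_range_eq_sum_levels (U := U) f]
    exact hpeak _ le_rfl (by omega)
  intro t ht hne
  rcases Nat.eq_zero_or_pos t with rfl | htpos
  · simpa using h0
  obtain ⟨i, rfl⟩ := Nat.exists_eq_add_of_le' htpos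
  rcases (show i = m ∨ i < m by omega) with rfl | him
  · exact hend
  by_cases hUi : U i
  · rw [sum_range_of_turn f him hUi]
    have hm := Nat.count_monotone U (show i ≤ m by omega)
    apply hpeak _ (by omega)
    intro hc
    rcases (show i < j ∨ j < i by omega) with h | h
    · have h1 := Nat.count_monotone U (show i + 1 ≤ j by omega)
      rw [Nat.count_succ, if_pos hUi] at h1
      omega
    · have h1 := Nat.count_monotone U (show j + 1 ≤ i by omega)
      rw [Nat.count_succ, if_pos hUj] at h1
      omega
  -- A point on the convex polygon is no higher than the larger of the two ends, and both ends are
  -- already strictly below the peak.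
  · rw [sum_range_of_turn (U := fun j => ¬ U j) f him hUi]
    have hm := Nat.count_monotone (fun j => ¬ U j) (show i ≤ m by omega)
    refine (sum_range_le_max_ends (N := Nat.count (fun j => ¬ U j) m + 1) ?_ (by omega)).trans_lt ?_
    · intro a b hab hb hle
      have ha' := levelSum_pos (U := fun j => ¬ U j) hr (c := a) (by omega)
      have hb' := levelSum_pos (U := fun j => ¬ U j) hr (c := b) (by omega)
      have h2 := antitone_slopes_of_step (μ := fun c => levelSum (fun j => ¬ U j) m
        (fun j => -w j) c / levelSum (fun j => ¬ U j) m r c) hU' hab (by omega)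
      have hw : ∀ c, levelSum (fun j => ¬ U j) m (fun j => -w j) c
          = - levelSum (fun j => ¬ U j) m w c := fun c => by simp [levelSum]
      simp only [hw, neg_div, neg_le_neg_iff] at h2
      rw [levelSum_sub_mul] at hle ⊢
      have h3 : levelSum (fun j => ¬ U j) m w b / levelSum (fun j => ¬ U j) m r b ≤ l := by
        rw [div_le_iff₀ hb']; linarith
      have h4 := (div_le_iff₀ ha').1 (h2.trans h3)
      linarith
    · rw [← sum_range_eq_sum_levels]
      exact max_lt h0 hend

/-- The supporting line of slope `l` at `j + 1` makes the sum of w - l r positive before the turn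
and negative after it. If s ≤ l, the first part stays positive for `s`; if l ≤ s, the second stays
negative, and the total being zero makes the first positive. -/
theorem chord_pos (hr : ∀ j ≤ m, 0 < r j) (hU : LevelsDecrease U m w r)
    (hU' : LevelsDecrease (fun j => ¬ U j) m (fun j => -w j) r) {a b j : ℕ} (haj : a ≤ j)
    (hjb : j < b) (hb : b ≤ m) (hUj : U j) {s : ℝ}
    (hs : ∑ i ∈ Ico a (b + 1), (w i - s * r i) = 0) :
    0 < ∑ i ∈ Ico a (j + 1), (w i - s * r i) := by
  obtain ⟨l, hl⟩ := exists_supporting_slope hr hU hU' (by omega : j < m) hUj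
  have h1 := hl a (by omega) (by omega)
  have h2 := hl (b + 1) (by omega) (by omega)
  rw [← sum_range_add_sum_Ico (fun i => w i - l * r i) (show a ≤ j + 1 by omega)] at h1
  rw [← sum_range_add_sum_Ico (fun i => w i - l * r i) (show j + 1 ≤ b + 1 by omega)] at h2
  rw [← sum_Ico_consecutive _ (show a ≤ j + 1 by omega) (show j + 1 ≤ b + 1 by omega)] at hs
  have hr1 : 0 < ∑ i ∈ Ico a (j + 1), r i :=
    sum_pos (fun i hi => hr i (by have := (mem_Ico.1 hi).2; omega)) (nonempty_Ico.2 (by omega))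
  have hr2 : 0 < ∑ i ∈ Ico (j + 1) (b + 1), r i :=
    sum_pos (fun i hi => hr i (by have := (mem_Ico.1 hi).2; omega)) (nonempty_Ico.2 (by omega))
  simp only [sum_sub_distrib, ← mul_sum] at h1 h2 hs ⊢
  rcases le_total s l with h | h
  · have := mul_le_mul_of_nonneg_right h hr1.le
    linarith
  · have := mul_le_mul_of_nonneg_right h hr2.le
    linarith

end Chord

theorem sum_mul_by_parts (g f : ℕ → ℝ) {a t : ℕ} (h : a ≤ t) :
    ∑ i ∈ Ico a (t + 1), g i * f i = g t * ∑ i ∈ Ico a (t + 1), f i +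
      ∑ i ∈ Ico a t, (g i - g (i + 1)) * ∑ l ∈ Ico a (i + 1), f l := by
  induction t, h using Nat.le_induction with
  | base => simp
  | succ t h ih =>
    rw [sum_Ico_succ_top (by omega), ih, sum_Ico_succ_top (by omega : a ≤ t + 1) f,
      sum_Ico_succ_top h fun i => (g i - g (i + 1)) * ∑ l ∈ Ico a (i + 1), f l]
    ring

/-- The numerical form of stability of the interval `[a, b]`: the weight function `g` plays the
role of the dimension vector of a subrepresentation. -/
theorem slope_lt_of_closed {U : ℕ → Prop} [DecidablePred U] {m : ℕ} {w r : ℕ → ℝ}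
    (hr : ∀ j ≤ m, 0 < r j) (hU : LevelsDecrease U m w r)
    (hU' : LevelsDecrease (fun j => ¬ U j) m (fun j => -w j) r) {a b : ℕ} (hab : a ≤ b)
    (hb : b ≤ m) {g : ℕ → ℝ} (hg : ∀ j ∈ Ico a (b + 1), 0 ≤ g j)
    (hup : ∀ j ∈ Ico a b, U j → g j ≤ g (j + 1)) (hdown : ∀ j ∈ Ico a b, ¬ U j → g (j + 1) ≤ g j)
    (hne : ∃ j ∈ Ico a b, g j ≠ g (j + 1)) :
    (∑ j ∈ Ico a (b + 1), g j * w j) / (∑ j ∈ Ico a (b + 1), g j * r j) <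
      (∑ j ∈ Ico a (b + 1), w j) / ∑ j ∈ Ico a (b + 1), r j := by
  set s := (∑ j ∈ Ico a (b + 1), w j) / ∑ j ∈ Ico a (b + 1), r j with hs
  have hrI : 0 < ∑ j ∈ Ico a (b + 1), r j :=
    sum_pos (fun i hi => hr i (by have := (mem_Ico.1 hi).2; omega)) (nonempty_Ico.2 (by omega))
  have h0 : ∑ i ∈ Ico a (b + 1), (w i - s * r i) = 0 := by
    rw [sum_sub_distrib, ← mul_sum, hs, div_mul_cancel₀ _ hrI.ne', sub_self]
  have hterm : ∀ j ∈ Ico a b, (g j - g (j + 1)) * ∑ i ∈ Ico a (j + 1), (w i - s * r i) ≤ 0 ∧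
      (g j ≠ g (j + 1) → (g j - g (j + 1)) * ∑ i ∈ Ico a (j + 1), (w i - s * r i) < 0) := by
    intro j hj
    have hj' := mem_Ico.1 hj
    by_cases hUj : U j
    · have h1 := chord_pos hr hU hU' hj'.1 hj'.2 hb hUj h0
      have h2 := hup j hj hUj
      exact ⟨mul_nonpos_of_nonpos_of_nonneg (by linarith) h1.le,
        fun hne => mul_neg_of_neg_of_pos (sub_neg.2 (lt_of_le_of_ne h2 hne)) h1⟩
    -- Reflecting the path by w ↦ -w exchanges rows and columns, so the same lemma puts the row
    -- breaks below the chord.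
    · have h1 := chord_pos (U := fun j => ¬ U j) (w := fun j => -w j) (s := -s) hr hU'
        (by simpa using hU) hj'.1 hj'.2 hb hUj (by
          rw [← neg_eq_zero, ← sum_neg_distrib, ← h0]
          exact sum_congr rfl fun _ _ => by ring)
      have h1' : ∑ i ∈ Ico a (j + 1), (w i - s * r i) < 0 := by
        rw [← neg_pos, ← sum_neg_distrib]
        convert h1 using 2
        ring
      have h2 := hdown j hj hUj
      exact ⟨mul_nonpos_of_nonneg_of_nonpos (by linarith) h1'.le,
        fun hne => mul_neg_of_pos_of_neg (sub_pos.2 (lt_of_le_of_ne h2 hne.symm)) h1'⟩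
  obtain ⟨j, hj, hgj⟩ := hne
  have hlt : ∑ i ∈ Ico a (b + 1), g i * (w i - s * r i) < 0 := by
    -- The boundary term disappears because w - s r sums to zero over the interval.
    rw [sum_mul_by_parts _ _ hab, h0, mul_zero, zero_add]
    exact sum_neg' (fun i hi => (hterm i hi).1) ⟨j, hj, (hterm j hj).2 hgj⟩
  have hj' := mem_Ico.1 hj
  -- Two adjacent values of `g` that differ are not both zero.
  have hgr : 0 < ∑ j ∈ Ico a (b + 1), g j * r j := by
    apply sum_pos'
    · intro i hi
      exact mul_nonneg (hg i hi) (hr i (by have := (mem_Ico.1 hi).2; omega)).le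
    · have hmem1 : j ∈ Ico a (b + 1) := mem_Ico.2 ⟨hj'.1, by omega⟩
      have hmem2 : j + 1 ∈ Ico a (b + 1) := mem_Ico.2 ⟨by omega, by omega⟩
      rcases (hg j hmem1).lt_or_eq with h | h
      · exact ⟨j, hmem1, mul_pos h (hr j (by omega))⟩
      · exact ⟨j + 1, hmem2, mul_pos (lt_of_le_of_ne (hg _ hmem2) (by rw [h]; exact hgj))
          (hr _ (by omega))⟩
  rw [div_lt_iff₀ hgr, mul_sum, ← sub_neg, ← sum_sub_distrib]
  refine lt_of_eq_of_lt (sum_congr rfl fun i _ => ?_) hlt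
  ring

/-- Arbitrary slopes can be prescribed, up to a shift, on the levels of `U` and of its complement
at the same time. -/
theorem exists_weights (U : ℕ → Prop) [DecidablePred U] (m : ℕ) (s t : ℕ → ℝ) :
    ∃ (w : ℕ → ℝ) (σ τ : ℝ),
      (∀ c ≤ Nat.count U m, levelSum U m w c = (s c - σ) * levelSum U m (fun _ => 1) c) ∧
      (∀ c ≤ Nat.count (fun j => ¬ U j) m, levelSum (fun j => ¬ U j) m w c =
        (t c - τ) * levelSum (fun j => ¬ U j) m (fun _ => 1) c) := by
  have key : ∀ (U : ℕ → Prop) [DecidablePred U] (s : ℕ → ℝ), ∃ (f : ℕ → ℝ) (σ : ℝ),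
      ∑ i ∈ range (m + 1), f i = 0 ∧
      ∀ c, levelSum U m f c = (s c - σ) * levelSum U m (fun _ => 1) c := by
    intro U _ s
    -- Subtracting the mean, which becomes the shift `σ`, makes the total zero, so that the paths
    -- for `U` and for its complement share both ends.
    refine ⟨fun i => s (Nat.count U i) - (∑ i ∈ range (m + 1), s (Nat.count U i)) / (m + 1),
      (∑ i ∈ range (m + 1), s (Nat.count U i)) / (m + 1), ?_, ?_⟩
    · rw [sum_sub_distrib, sum_const, card_range, nsmul_eq_mul]
      push_cast
      field_simp
      ring
    · intro c
      rw [levelSum, levelSum, mul_sum]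
      exact sum_congr rfl fun i hi => by rw [(mem_filter.1 hi).2, mul_one]
  -- Level sums depend only on the partial sums at the turns of `U` and at the end.
  have pin : ∀ (U : ℕ → Prop) [DecidablePred U] (f w : ℕ → ℝ),
      (∀ j < m, U j → ∑ i ∈ range (j + 1), w i = ∑ i ∈ range (j + 1), f i) →
      ∑ i ∈ range (m + 1), w i = ∑ i ∈ range (m + 1), f i →
      ∀ c ≤ Nat.count U m, levelSum U m w c = levelSum U m f c := by
    intro U _ f w h hm
    have hA : ∀ q ≤ Nat.count U m + 1,
        ∑ c ∈ range q, levelSum U m w c = ∑ c ∈ range q, levelSum U m f c := by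
      intro q hq
      rcases Nat.eq_zero_or_pos q with rfl | hq0
      · simp
      rcases hq.eq_or_lt with rfl | hq
      · rw [← sum_range_eq_sum_levels, ← sum_range_eq_sum_levels, hm]
      obtain ⟨i, hi, hUi, rfl⟩ : ∃ i < m, U i ∧ Nat.count U i + 1 = q := by
        have hlt : q - 1 < Nat.count U m := by omega
        refine ⟨Nat.nth U (q - 1), Nat.nth_lt_of_lt_count hlt, Nat.nth_mem _ ?_, ?_⟩
        · intro hf
          exact hlt.trans_le (Nat.count_le_card hf m)
        · rw [Nat.count_nth]
          · omega
          · intro hf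
            exact hlt.trans_le (Nat.count_le_card hf m)
      rw [← sum_range_of_turn _ hi hUi, ← sum_range_of_turn _ hi hUi, h i hi hUi]
    intro c hc
    have h1 := hA c (by omega)
    have h2 := hA (c + 1) (by omega)
    rw [sum_range_succ, sum_range_succ, h1] at h2
    exact add_left_cancel h2
  obtain ⟨f, σ, hf0, hf⟩ := key U s
  obtain ⟨g, τ, hg0, hg⟩ := key (fun j => ¬ U j) t
  -- The desired path of partial sums: at an interior point it takes the height of the `f`-path or
  -- the `g`-path, according to the arrow just passed.
  let P : ℕ → ℝ := fun i => if i = 0 then 0 else if i = m + 1 then 0 else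
    if U (i - 1) then ∑ l ∈ range i, f l else ∑ l ∈ range i, g l
  have hP : ∀ i, ∑ l ∈ range i, (P (l + 1) - P l) = P i := by
    intro i
    rw [sum_range_sub]
    simp [P]
  refine ⟨fun i => P (i + 1) - P i, σ, τ, fun c hc => ?_, fun c hc => ?_⟩
  · rw [← hf]
    refine pin U f _ (fun j hj hUj => ?_) ?_ c hc
    · rw [hP]
      simp [P, hj.ne, hUj]
    · rw [hP, hf0]
      simp [P]
  · rw [← hg]
    refine pin _ g _ (fun j hj hUj => ?_) ?_ c hc
    · rw [hP]
      simp [P, hj.ne, hUj]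
    · rw [hP, hg0]
      simp [P]

end Numerics

/-! ### Splitting off strings: indecomposables are interval modules. -/

open Module

theorem exists_dual_of_notMem {k E : Type*} [Field k] [AddCommGroup E] [Module k E]
    {K : Submodule k E} {x : E} (hx : x ∉ K) :
    ∃ φ : Dual k E, φ x = 1 ∧ ∀ y ∈ K, φ y = 0 := by
  obtain ⟨φ, hφ, hK⟩ := K.exists_le_ker_of_notMem hx
  refine ⟨(φ x)⁻¹ • φ, by simp [hφ], fun y hy => ?_⟩
  have : φ y = 0 := hK hy
  simp [this]

section TypeA

variable {k : Type u} [Field k] {V : Type v} [Quiver.{w} V] {m : ℕ} {e : Fin (m + 1) ≃ V}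

/-- Compatible vectors `x` and functionals `φ`, dual to each other, along the interval from `i`
to `b`; only the arrows between vertices from `i` onwards are taken into account. -/
structure QuiverRep.IsString (M : QuiverRep k V) (e : Fin (m + 1) ≃ V) (i b : Fin (m + 1))
    (x : ∀ j, M.space (e j)) (φ : ∀ j, Dual k (M.space (e j))) : Prop where
  le : i ≤ b
  pairing : ∀ j, i ≤ j → j ≤ b → φ j (x j) = 1
  vec_zero : ∀ j, ¬ (i ≤ j ∧ j ≤ b) → x j = 0
  dual_zero : ∀ j, ¬ (i ≤ j ∧ j ≤ b) → φ j = 0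
  vec_right : ∀ j : Fin m, i ≤ j.castSucc → ∀ α : e j.castSucc ⟶ e j.succ,
    M.map α (x j.castSucc) = x j.succ
  dual_right : ∀ j : Fin m, i ≤ j.castSucc → j.succ ≤ b → ∀ α : e j.castSucc ⟶ e j.succ,
    (φ j.succ).comp (M.map α) = φ j.castSucc
  vec_left : ∀ j : Fin m, i ≤ j.castSucc → j.succ ≤ b → ∀ α : e j.succ ⟶ e j.castSucc,
    M.map α (x j.succ) = x j.castSucc
  dual_left : ∀ j : Fin m, i ≤ j.castSucc → ∀ α : e j.succ ⟶ e j.castSucc,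
    (φ j.castSucc).comp (M.map α) = φ j.succ

theorem IsTypeA.right_or_left (he : IsTypeA e) (j : Fin m) :
    (∃ α : e j.castSucc ⟶ e j.succ, (∀ β, β = α) ∧ IsEmpty (e j.succ ⟶ e j.castSucc)) ∨
    (∃ α : e j.succ ⟶ e j.castSucc, (∀ β, β = α) ∧ IsEmpty (e j.castSucc ⟶ e j.succ)) := by
  obtain ⟨hs, ⟨a⟩⟩ := Nat.card_eq_one_iff_unique.1 (he.card_arrows j)
  rcases a with α | α
  · refine Or.inl ⟨α, fun β => Sum.inl_injective (hs.elim _ _), ⟨fun β => ?_⟩⟩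
    exact Sum.inr_ne_inl (hs.elim (Sum.inr β) (Sum.inl α))
  · refine Or.inr ⟨α, fun β => Sum.inr_injective (hs.elim _ _), ⟨fun β => ?_⟩⟩
    exact Sum.inr_ne_inl (hs.elim (Sum.inr α) (Sum.inl β))

variable {M : QuiverRep k V}

/-- A string may stop at `i` when the vector dies along an arrow to the next vertex, or the
functional kills the image of an arrow from it. -/
theorem QuiverRep.exists_isString_singleton (i : Fin (m + 1))
    {x₀ : M.space (e i)} {φ₀ : Dual k (M.space (e i))} (h : φ₀ x₀ = 1)
    (hr : ∀ j : Fin m, i = j.castSucc → ∀ α : e i ⟶ e j.succ, M.map α x₀ = 0)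
    (hl : ∀ j : Fin m, i = j.castSucc → ∀ α : e j.succ ⟶ e i, φ₀.comp (M.map α) = 0) :
    ∃ x φ, M.IsString e i i x φ ∧ x i = x₀ ∧ φ i = φ₀ := by
  refine ⟨Function.update 0 i x₀, Function.update 0 i φ₀, ?_, by simp, by simp⟩
  have hz : ∀ j, ¬ (i ≤ j ∧ j ≤ i) → j ≠ i := by rintro j hj rfl; simp at hj
  constructor
  · exact le_rfl
  · intro j h1 h2
    obtain rfl := le_antisymm h1 h2
    simpa using h
  · intro j hj
    simp [Function.update_of_ne (hz j hj)]
  · intro j hj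
    simp [Function.update_of_ne (hz j hj)]
  · intro j hij α
    have hs : j.succ ≠ i := fun h => by
      subst h; exact absurd hij (by simp [Fin.le_def])
    rw [Function.update_of_ne hs]
    rcases eq_or_ne i j.castSucc with rfl | hne
    · simpa using hr j rfl α
    · simp [Function.update_of_ne hne.symm]
  · intro j h1 h2
    exact absurd (h1.trans_lt (Fin.castSucc_lt_succ)) (not_lt.2 h2)
  · intro j h1 h2
    exact absurd (h1.trans_lt (Fin.castSucc_lt_succ)) (not_lt.2 h2)
  · intro j hij α
    have hs : j.succ ≠ i := fun h => by
      subst h; exact absurd hij (by simp [Fin.le_def])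
    rw [Function.update_of_ne hs]
    rcases eq_or_ne i j.castSucc with rfl | hne
    · simpa using hl j rfl α
    · simp [Function.update_of_ne hne.symm]

theorem QuiverRep.IsString.extend {i : Fin m} {b : Fin (m + 1)} {x φ}
    (h : M.IsString e i.succ b x φ) {x₀ : M.space (e i.castSucc)}
    {φ₀ : Dual k (M.space (e i.castSucc))} (hp : φ₀ x₀ = 1)
    (hr : ∀ α : e i.castSucc ⟶ e i.succ,
      M.map α x₀ = x i.succ ∧ (φ i.succ).comp (M.map α) = φ₀)
    (hl : ∀ α : e i.succ ⟶ e i.castSucc,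
      M.map α (x i.succ) = x₀ ∧ φ₀.comp (M.map α) = φ i.succ) :
    M.IsString e i.castSucc b (Function.update x i.castSucc x₀)
      (Function.update φ i.castSucc φ₀) := by
  have hib : i.castSucc ≤ b := Fin.castSucc_lt_succ.le.trans h.le
  have hcase : ∀ j : Fin (m + 1), i.castSucc ≤ j → j ≠ i.castSucc → i.succ ≤ j := by
    intro j h1 h2
    simp only [Fin.le_def, ne_eq, Fin.ext_iff, Fin.val_castSucc, Fin.val_succ] at *
    omega
  have hs : ∀ j : Fin m, i.castSucc ≤ j.castSucc → j.succ ≠ i.castSucc := by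
    intro j h1
    simp only [Fin.le_def, ne_eq, Fin.ext_iff, Fin.val_castSucc, Fin.val_succ] at *
    omega
  have hz : ∀ j, ¬ (i.castSucc ≤ j ∧ j ≤ b) → j ≠ i.castSucc ∧ ¬ (i.succ ≤ j ∧ j ≤ b) := by
    intro j hj
    constructor
    · rintro rfl
      exact hj ⟨le_rfl, hib⟩
    · exact fun h' => hj ⟨Fin.castSucc_lt_succ.le.trans h'.1, h'.2⟩
  constructor
  · exact hib
  · intro j h1 h2
    by_cases hj : j = i.castSucc
    · subst hj; simpa using hp
    · simpa [Function.update_of_ne hj] using h.pairing j (hcase j h1 hj) h2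
  · intro j hj
    rw [Function.update_of_ne (hz j hj).1, h.vec_zero j (hz j hj).2]
  · intro j hj
    rw [Function.update_of_ne (hz j hj).1, h.dual_zero j (hz j hj).2]
  · intro j h1 α
    rw [Function.update_of_ne (hs j h1)]
    by_cases hj : j = i
    · subst hj; simpa using (hr α).1
    · have hj' : j.castSucc ≠ i.castSucc := fun h => hj (Fin.castSucc_injective _ h)
      rw [Function.update_of_ne hj', h.vec_right j (hcase _ h1 hj')]
  · intro j h1 h2 α
    rw [Function.update_of_ne (hs j h1)]
    by_cases hj : j = i
    · subst hj; simpa using (hr α).2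
    · have hj' : j.castSucc ≠ i.castSucc := fun h => hj (Fin.castSucc_injective _ h)
      rw [Function.update_of_ne hj', h.dual_right j (hcase _ h1 hj') h2]
  · intro j h1 h2 α
    rw [Function.update_of_ne (hs j h1)]
    by_cases hj : j = i
    · subst hj; simpa using (hl α).1
    · have hj' : j.castSucc ≠ i.castSucc := fun h => hj (Fin.castSucc_injective _ h)
      rw [Function.update_of_ne hj', h.vec_left j (hcase _ h1 hj') h2]
  · intro j h1 α
    rw [Function.update_of_ne (hs j h1)]
    by_cases hj : j = i
    · subst hj; simpa using (hl α).2
    · have hj' : j.castSucc ≠ i.castSucc := fun h => hj (Fin.castSucc_injective _ h)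
      rw [Function.update_of_ne hj', h.dual_left j (hcase _ h1 hj')]

/-- Every nonzero subquotient `W / K` at the vertex `i` is seen by some string that starts
at `i`. -/
theorem QuiverRep.exists_isString (he : IsTypeA e) (M : QuiverRep k V) (i : Fin (m + 1)) :
    ∀ K W : Submodule k (M.space (e i)), K ≤ W → ¬ W ≤ K →
      ∃ b x φ, M.IsString e i b x φ ∧ x i ∈ W ∧ ∀ y ∈ K, φ i y = 0 := by
  induction i using Fin.reverseInduction with
  | last =>
    intro K W _ hWK
    obtain ⟨x₀, hxW, hxK⟩ := Set.not_subset.1 hWK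
    obtain ⟨φ₀, hφ, hφK⟩ := exists_dual_of_notMem hxK
    obtain ⟨x, φ, hs, rfl, rfl⟩ := exists_isString_singleton (Fin.last m) hφ
      (fun j hj => absurd hj (Fin.castSucc_lt_last j).ne')
      (fun j hj => absurd hj (Fin.castSucc_lt_last j).ne')
    exact ⟨_, x, φ, hs, hxW, hφK⟩
  | cast i ih =>
    intro K W hKW hWK
    rcases he.right_or_left i with ⟨α, hα, hemp⟩ | ⟨α, hα, hemp⟩
    -- If the kernel meets `W` only inside `K`, the subquotient survives under images and the string
    -- continues; otherwise a kernel vector outside `K` ends it here.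
    · by_cases hker : W ⊓ LinearMap.ker (M.map α) ≤ K
      · have hne : ¬ W.map (M.map α) ≤ K.map (M.map α) := by
          intro hle
          apply hWK
          intro y hy
          obtain ⟨z, hz, hzy⟩ := hle (Submodule.mem_map_of_mem hy)
          have : y - z ∈ K := hker ⟨sub_mem hy (hKW hz), by simp [hzy]⟩
          simpa using add_mem this hz
        obtain ⟨b, x, φ, hs, ⟨x₀, hx₀, hx⟩, hφ⟩ := ih _ _ (Submodule.map_mono hKW) hne
        refine ⟨b, _, _, hs.extend (x₀ := x₀) (φ₀ := (φ i.succ).comp (M.map α)) ?_ ?_ ?_, ?_, ?_⟩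
        · rw [LinearMap.comp_apply, hx]
          exact hs.pairing _ le_rfl hs.le
        · intro β
          rw [hα β]
          exact ⟨hx, rfl⟩
        · exact fun β => hemp.elim β
        · simpa using hx₀
        · intro y hy
          simpa using hφ _ (Submodule.mem_map_of_mem hy)
      · obtain ⟨x₀, ⟨hxW, hxker⟩, hxK⟩ := Set.not_subset.1 hker
        obtain ⟨φ₀, hφ, hφK⟩ := exists_dual_of_notMem hxK
        obtain ⟨x, φ, hs, rfl, rfl⟩ := exists_isString_singleton i.castSucc hφ
          (fun j hj β => by
            obtain rfl := Fin.castSucc_injective _ hj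
            rw [hα β]; exact hxker)
          (fun j hj β => by
            obtain rfl := Fin.castSucc_injective _ hj
            exact hemp.elim β)
        exact ⟨_, x, φ, hs, hxW, hφK⟩
    -- Dually, if `W` lies in `K` plus the range, the subquotient lifts to preimages; otherwise a
    -- vector outside that sum and a functional killing the sum end the string here.
    · by_cases hran : W ≤ K ⊔ LinearMap.range (M.map α)
      · have hne : ¬ W.comap (M.map α) ≤ K.comap (M.map α) := by
          intro hle
          apply hWK
          intro y hy
          obtain ⟨z, hz, _, ⟨u, rfl⟩, rfl⟩ := Submodule.mem_sup.1 (hran hy)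
          have hu : u ∈ W.comap (M.map α) := by
            have := sub_mem hy (hKW hz)
            simpa using this
          exact add_mem hz (hle hu)
        obtain ⟨b, x, φ, hs, hxW, hφ⟩ := ih _ _ (Submodule.comap_mono hKW) hne
        -- The functional kills the preimage of `K`, which is the kernel of the composite into the
        -- quotient by `K`, so it extends to that quotient.
        obtain ⟨ψ, hψ⟩ : φ i.succ ∈ LinearMap.range (K.mkQ.comp (M.map α)).dualMap := by
          rw [LinearMap.range_dualMap_eq_dualAnnihilator_ker, Submodule.mem_dualAnnihilator]
          intro y hy
          apply hφ
          simpa using hy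
        have hψ' : (ψ.comp K.mkQ).comp (M.map α) = φ i.succ := hψ
        refine ⟨b, _, _, hs.extend (x₀ := M.map α (x i.succ)) (φ₀ := ψ.comp K.mkQ) ?_ ?_ ?_,
          ?_, ?_⟩
        · rw [← hs.pairing _ le_rfl hs.le, ← hψ']
          rfl
        · exact fun β => hemp.elim β
        · intro β
          rw [hα β]
          exact ⟨rfl, hψ'⟩
        · simpa using hxW
        · intro y hy
          have : K.mkQ y = 0 := by simpa using hy
          simp [this]
      · obtain ⟨x₀, hxW, hxK⟩ := Set.not_subset.1 hran
        obtain ⟨φ₀, hφ, hφK⟩ := exists_dual_of_notMem hxK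
        obtain ⟨x, φ, hs, rfl, rfl⟩ := exists_isString_singleton i.castSucc hφ
          (fun j hj β => by
            obtain rfl := Fin.castSucc_injective _ hj
            exact hemp.elim β)
          (fun j hj β => by
            obtain rfl := Fin.castSucc_injective _ hj
            rw [hα β]
            ext y
            exact hφK _ (Submodule.mem_sup_right ⟨y, rfl⟩))
        exact ⟨_, x, φ, hs, hxW, fun y hy => hφK y (Submodule.mem_sup_left hy)⟩

theorem IsTypeA.exists_of_arrow (he : IsTypeA e) {a b : V} (α : a ⟶ b) :
    ∃ j : Fin m, (a = e j.castSucc ∧ b = e j.succ) ∨ (a = e j.succ ∧ b = e j.castSucc) := by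
  obtain ⟨p, rfl⟩ := e.surjective a
  obtain ⟨q, rfl⟩ := e.surjective b
  by_cases h1 : (p : ℕ) + 1 = q
  · exact ⟨⟨p, by omega⟩, Or.inl ⟨rfl, congrArg e (Fin.ext h1.symm)⟩⟩
  by_cases h2 : (q : ℕ) + 1 = p
  · exact ⟨⟨q, by omega⟩, Or.inr ⟨congrArg e (Fin.ext h2.symm), rfl⟩⟩
  exact ((he.no_arrow p q h1 h2).false α).elim

/-- An indecomposable representation of a quiver of type `𝔸` is one-dimensional on an interval
and zero elsewhere, and the maps inside the interval are injective. -/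
theorem QuiverRep.IsIndecomposable.exists_interval (he : IsTypeA e) (hM : M.IsIndecomposable) :
    ∃ a b : Fin (m + 1), a ≤ b ∧
      (∀ j, finrank k (M.space (e j)) = if a ≤ j ∧ j ≤ b then 1 else 0) ∧
      ∀ j l, a ≤ j → j ≤ b → a ≤ l → l ≤ b → ∀ α : e j ⟶ e l, Function.Injective (M.map α) := by
  classical
  obtain ⟨a, ha, hmin⟩ : ∃ a : Fin (m + 1), Nontrivial (M.space (e a)) ∧
      ∀ j < a, Subsingleton (M.space (e j)) := by
    obtain ⟨z, hz⟩ := hM.1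
    have hne : ({j | Nontrivial (M.space (e j))} : Set (Fin (m + 1))).Nonempty :=
      ⟨e.symm z, by simpa using hz⟩
    refine ⟨WellFounded.min (wellFounded_lt (α := Fin (m + 1))) _ hne,
      WellFounded.min_mem _ _ hne, fun j hj => ?_⟩
    by_contra h
    exact WellFounded.not_lt_min (wellFounded_lt (α := Fin (m + 1)))
      {j | Nontrivial (M.space (e j))} (not_subsingleton_iff_nontrivial.1 h) hj
  -- As `a` is the leftmost vertex in the support, no condition to the left of the string is needed.
  obtain ⟨b, x, φ, hs, -, -⟩ := M.exists_isString he a ⊥ ⊤ bot_le (by simp)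
  have hcase : ∀ j : Fin m, a ≤ j.castSucc ∨ Subsingleton (M.space (e j.castSucc)) := fun j =>
    (le_or_gt a j.castSucc).imp_right (hmin _)
  have hx : ∀ j l, ∀ α : e j ⟶ e l, M.map α (x j) ∈ k ∙ x l := by
    intro j l α
    obtain ⟨i, ⟨h1, h2⟩ | ⟨h1, h2⟩⟩ := he.exists_of_arrow α
    all_goals obtain rfl := e.injective h1; obtain rfl := e.injective h2
    · rcases hcase i with h | h
      · rw [hs.vec_right i h]
        exact Submodule.mem_span_singleton_self _
      · rw [Subsingleton.elim (x i.castSucc) 0, map_zero]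
        exact zero_mem _
    · rcases hcase i with h | h
      · by_cases hb : i.succ ≤ b
        · rw [hs.vec_left i h hb]
          exact Submodule.mem_span_singleton_self _
        · rw [hs.vec_zero i.succ fun h' => hb h'.2, map_zero]
          exact zero_mem _
      · rw [Subsingleton.elim (M.map α (x i.succ)) 0]
        exact zero_mem _
  have hφ : ∀ j l, ∀ α : e j ⟶ e l, ∀ y, φ j y = 0 → φ l (M.map α y) = 0 := by
    intro j l α y hy
    obtain ⟨i, ⟨h1, h2⟩ | ⟨h1, h2⟩⟩ := he.exists_of_arrow α
    all_goals obtain rfl := e.injective h1; obtain rfl := e.injective h2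
    · rcases hcase i with h | h
      · by_cases hb : i.succ ≤ b
        · rw [← hs.dual_right i h hb α] at hy
          exact hy
        · rw [hs.dual_zero i.succ fun h' => hb h'.2, LinearMap.zero_apply]
      · rw [Subsingleton.elim y 0, map_zero, map_zero]
    · rcases hcase i with h | h
      · rw [← hs.dual_left i h α] at hy
        exact hy
      · rw [Subsingleton.elim (M.map α y) 0, map_zero]
  have hpair : ∀ j, φ j (x j) = 1 ∨ (x j = 0 ∧ φ j = 0) := fun j => by
    by_cases h : a ≤ j ∧ j ≤ b
    · exact Or.inl (hs.pairing j h.1 h.2)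
    · exact Or.inr ⟨hs.vec_zero j h, hs.dual_zero j h⟩
  obtain ⟨x', hx'⟩ : ∃ x' : ∀ z, M.space z, ∀ j, x' (e j) = x j :=
    ⟨Equiv.piCongrLeft M.space e x, Equiv.piCongrLeft_apply_apply M.space e x⟩
  obtain ⟨φ', hφ'⟩ : ∃ φ' : ∀ z, Dual k (M.space z), ∀ j, φ' (e j) = φ j :=
    ⟨Equiv.piCongrLeft (fun z => Dual k (M.space z)) e φ,
      Equiv.piCongrLeft_apply_apply (fun z => Dual k (M.space z)) e φ⟩
  simp only [← hx', ← hφ'] at hx hφ hpair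
  -- The spans of the string vectors and the kernels of the dual functionals are complementary
  -- subrepresentations; the first is nonzero at `a`, so indecomposability kills the second.
  let N : M.Subrep :=
    { space := fun z => k ∙ x' z
      map_mem := by
        intro p q α y hy
        obtain ⟨i, rfl⟩ := e.surjective p
        obtain ⟨l, rfl⟩ := e.surjective q
        obtain ⟨c, rfl⟩ := Submodule.mem_span_singleton.1 hy
        rw [map_smul]
        exact Submodule.smul_mem _ _ (hx i l α) }
  let N' : M.Subrep :=
    { space := fun z => LinearMap.ker (φ' z)
      map_mem := by
        intro p q α y hy
        obtain ⟨i, rfl⟩ := e.surjective p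
        obtain ⟨l, rfl⟩ := e.surjective q
        exact hφ i l α y hy }
  have hcompl : ∀ z, IsCompl (N.space z) (N'.space z) := by
    intro z
    obtain ⟨j, rfl⟩ := e.surjective z
    rcases hpair j with h | ⟨h, h'⟩
    · constructor
      · rw [Submodule.disjoint_def]
        intro y hy hy'
        obtain ⟨c, rfl⟩ := Submodule.mem_span_singleton.1 hy
        have hc : c = 0 := by simpa [N', h] using hy'
        rw [hc, zero_smul]
      · rw [codisjoint_iff, eq_top_iff]
        intro y _
        refine Submodule.mem_sup.2 ⟨φ' (e j) y • x' (e j),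
          Submodule.smul_mem _ _ (Submodule.mem_span_singleton_self _),
          y - φ' (e j) y • x' (e j), ?_, by simp⟩
        simp [N', h]
    · simp only [N, N', h, h', Submodule.span_zero_singleton, LinearMap.ker_zero]
      exact isCompl_bot_top
  have hN : ∀ j, ∀ y : M.space (e j), φ j y = 0 → y = 0 := by
    rcases hM.2 N N' hcompl with h | h
    · have h0 : x' (e a) = 0 := by simpa [N] using h (e a)
      have h1 := hs.pairing a le_rfl hs.le
      rw [← hx', h0, map_zero] at h1
      exact absurd h1 zero_ne_one
    · intro j y hy
      have hmem : y ∈ N'.space (e j) := by rw [← hφ'] at hy; exact hy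
      rw [h (e j)] at hmem
      exact hmem
  refine ⟨a, b, hs.le, fun j => ?_, fun j l h1 h2 h3 h4 α => ?_⟩
  · split_ifs with h
    · apply finrank_eq_one (x j)
      · intro h0
        have := hs.pairing j h.1 h.2
        simp [h0] at this
      · intro y
        refine ⟨φ j y, (sub_eq_zero.1 (hN j _ ?_)).symm⟩
        simp [hs.pairing j h.1 h.2]
    · rw [finrank_zero_iff]
      exact subsingleton_of_forall_eq 0 fun y => hN j y (by simp [hs.dual_zero j h])
  · rw [injective_iff_map_eq_zero]
    intro y hy
    apply hN
    obtain ⟨i, ⟨h5, h6⟩ | ⟨h5, h6⟩⟩ := he.exists_of_arrow α <;>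
      (obtain rfl := e.injective h5; obtain rfl := e.injective h6)
    · rw [← hs.dual_right i h1 h4 α, LinearMap.comp_apply, hy, map_zero]
    · rw [← hs.dual_left i h3 α, LinearMap.comp_apply, hy, map_zero]

end TypeA

/-! ### Dimension vectors and central charges in coordinates. -/

section Coordinates

variable {k : Type u} [Field k] {V : Type v} [Quiver.{w} V]

open Classical in
theorem QuiverRep.finrank_ofSet (S : Set V) (z : V) :
    finrank k ((ofSet k S).space z) = if z ∈ S then 1 else 0 := by
  change finrank k ((if z ∈ S then ⊤ else ⊥ : Submodule k k)) = _
  by_cases h : z ∈ S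
  · rw [if_pos h, if_pos h, finrank_top, finrank_self]
  · rw [if_neg h, if_neg h, finrank_bot]

open Classical in
theorem QuiverRep.dimVec_ofSet (S : Set V) :
    (ofSet k S).dimVec = fun z => if z ∈ S then 1 else 0 := by
  ext z
  rw [dimVec, finrank_ofSet]
  split_ifs <;> simp

theorem QuiverRep.injective_map_ofSet {S : Set V} {a b : V} (ha : a ∈ S) (hb : b ∈ S) (α : a ⟶ b) :
    Function.Injective ((ofSet k S).map α) := by
  have h : (ofSet k S).map α = _ := dif_pos ⟨ha, hb⟩
  rw [h]
  exact Submodule.inclusion_injective _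

theorem QuiverRep.Subrep.finrank_le_of_injective {M : QuiverRep k V} (N : M.Subrep) {a b : V}
    (α : a ⟶ b) (hα : Function.Injective (M.map α)) :
    finrank k (N.space a) ≤ finrank k (N.space b) :=
  LinearMap.finrank_le_finrank_of_injective
    (f := (M.map α).restrict (p := N.space a) (q := N.space b) (N.map_mem α))
    fun _ _ h => Subtype.ext (hα (congrArg Subtype.val h))

variable [Fintype V]

omit [Quiver.{w} V] in
theorem exists_eq_ofCoords (Z : (V → ℤ) →+ ℂ) : ∃ p, Z = ofCoords p := by
  classical
  refine ⟨(fun z => (Z (Pi.single z 1)).re, fun z => (Z (Pi.single z 1)).im), ?_⟩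
  apply AddMonoidHom.functions_ext
  intro i x
  have hx : (Pi.single i x : V → ℤ) = x • Pi.single i 1 := by
    rw [← Pi.single_smul]; simp
  rw [hx, map_zsmul, map_zsmul]
  congr 1
  apply Complex.ext <;> simp [ofCoords, Pi.single_apply]

omit [Quiver.{w} V] in
theorem slopeOf_ofCoords (p : (V → ℝ) × (V → ℝ)) (x : V → ℤ) :
    slopeOf (ofCoords p) x = (∑ z, p.1 z * (x z : ℝ)) / ∑ z, p.2 z * (x z : ℝ) := rfl

theorem isCentralCharge_ofCoords {p : (V → ℝ) × (V → ℝ)} :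
    IsCentralCharge k (ofCoords p) ↔ ∀ z, 0 < p.2 z := by
  classical
  constructor
  · intro h z
    have hz := h (QuiverRep.ofSet k {z}) ⟨z, by
      apply nontrivial_of_finrank_pos (R := k)
      rw [QuiverRep.finrank_ofSet]
      simp⟩
    rw [QuiverRep.dimVec_ofSet] at hz
    simpa [ofCoords] using hz
  · rintro h M ⟨z, hz⟩
    change 0 < ∑ z, p.2 z * ((M.dimVec z : ℤ) : ℝ)
    apply Finset.sum_pos'
    · intro y _
      exact mul_nonneg (h y).le (by simp [QuiverRep.dimVec])
    · refine ⟨z, Finset.mem_univ _, mul_pos (h z) ?_⟩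
      simp only [QuiverRep.dimVec, Int.cast_natCast, Nat.cast_pos]
      exact finrank_pos

end Coordinates

/-! ### Columns and rows as levels; sufficiency of the inequalities. -/

section TypeA

variable {k : Type u} [Field k] {V : Type v} [Quiver.{w} V] {m : ℕ} {e : Fin (m + 1) ≃ V}

/-- The arrow between the `j`-th vertex and the next one points to the next one. -/
def PointsRight (e : Fin (m + 1) ≃ V) (j : ℕ) : Prop :=
  ∃ h : j < m, Nonempty (e (⟨j, h⟩ : Fin m).castSucc ⟶ e (⟨j, h⟩ : Fin m).succ)

instance (e : Fin (m + 1) ≃ V) : DecidablePred (PointsRight e) := Classical.decPred _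

theorem pointsRight_iff {j : Fin m} :
    PointsRight e j ↔ Nonempty (e j.castSucc ⟶ e j.succ) :=
  ⟨fun ⟨_, h⟩ => h, fun h => ⟨j.2, h⟩⟩

theorem IsTypeA.not_pointsRight_iff (he : IsTypeA e) {j : Fin m} :
    ¬ PointsRight e j ↔ Nonempty (e j.succ ⟶ e j.castSucc) := by
  rw [pointsRight_iff]
  rcases he.right_or_left j with ⟨α, -, h⟩ | ⟨α, -, h⟩
  · simp [h, show Nonempty (e j.castSucc ⟶ e j.succ) from ⟨α⟩]
  · simp [h, show Nonempty (e j.succ ⟶ e j.castSucc) from ⟨α⟩]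

theorem xCoord_eq_count (e : Fin (m + 1) ≃ V) (i : Fin (m + 1)) :
    xCoord e i = Nat.count (PointsRight e) i := by
  induction i using Fin.induction with
  | zero => simp [xCoord]
  | succ j ih =>
    rw [xCoord, Fin.induction_succ, ← xCoord, ih, Fin.val_succ, Nat.count_succ, Fin.val_castSucc]
    by_cases h : PointsRight e j
    · rw [if_pos h, if_pos (pointsRight_iff.1 h)]
    · rw [if_neg h, if_neg fun h' => h (pointsRight_iff.2 h'), add_zero]

theorem IsTypeA.yCoord_eq_count (he : IsTypeA e) (i : Fin (m + 1)) :
    yCoord e i = Nat.count (fun j => ¬ PointsRight e j) i := by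
  induction i using Fin.induction with
  | zero => simp [yCoord]
  | succ j ih =>
    rw [yCoord, Fin.induction_succ, ← yCoord, ih, Fin.val_succ, Nat.count_succ, Fin.val_castSucc]
    by_cases h : PointsRight e j
    · rw [if_neg (not_not.2 h), if_neg fun h' => he.not_pointsRight_iff.2 h' h, add_zero]
    · rw [if_pos h, if_pos (he.not_pointsRight_iff.1 h)]

theorem IsTypeA.xCoord_add_yCoord (he : IsTypeA e) (i : Fin (m + 1)) :
    xCoord e i + yCoord e i = i := by
  rw [xCoord_eq_count, he.yCoord_eq_count]
  induction (i : ℕ) with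
  | zero => simp
  | succ j ih => rw [Nat.count_succ, Nat.count_succ]; split_ifs <;> omega

/-- A function on the vertices as a sequence, extended by zero. -/
def vertexSeq (e : Fin (m + 1) ≃ V) (f : V → ℝ) (j : ℕ) : ℝ :=
  if h : j < m + 1 then f (e ⟨j, h⟩) else 0

omit [Quiver.{w} V] in
@[simp]
theorem vertexSeq_val (e : Fin (m + 1) ≃ V) (f : V → ℝ) (j : Fin (m + 1)) :
    vertexSeq e f j = f (e j) := dif_pos j.2

omit [Quiver.{w} V] in
theorem vertexSeq_pos {f : V → ℝ} (hf : ∀ z, 0 < f z) : ∀ j ≤ m, 0 < vertexSeq e f j :=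
  fun j hj => by rw [vertexSeq, dif_pos (by omega)]; exact hf _

/-- The slopes of the columns decrease and those of the rows increase. -/
def LatticeIneqs (e : Fin (m + 1) ≃ V) (p : (V → ℝ) × (V → ℝ)) : Prop :=
  LevelsDecrease (PointsRight e) m (vertexSeq e p.1) (vertexSeq e p.2) ∧
  LevelsDecrease (fun j => ¬ PointsRight e j) m (fun j => - vertexSeq e p.1 j) (vertexSeq e p.2)

variable [Fintype V]

omit [Quiver.{w} V] in
theorem sum_eq_sum_vertexSeq (e : Fin (m + 1) ≃ V) (f : V → ℝ) :
    ∑ z, f z = ∑ j ∈ Finset.range (m + 1), vertexSeq e f j := by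
  rw [Finset.sum_range, ← e.sum_comp]
  simp

omit [Quiver.{w} V] in
open Classical in
theorem sum_mul_indicator_eq_levelSum {U : ℕ → Prop} [DecidablePred U] {S : Set V} {c : ℕ}
    (hS : ∀ j, e j ∈ S ↔ Nat.count U j = c) (f : V → ℝ) :
    ∑ z, f z * (((if z ∈ S then 1 else 0 : ℤ)) : ℝ) = levelSum U m (vertexSeq e f) c := by
  rw [levelSum, Finset.sum_filter, Finset.sum_range, ← e.sum_comp]
  apply Finset.sum_congr rfl
  intro j _
  simp only [hS, vertexSeq_val]
  split_ifs <;> simp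

omit [Fintype V] in
theorem mem_colSet (e : Fin (m + 1) ≃ V) {c : ℕ} (j : Fin (m + 1)) :
    e j ∈ colSet e c ↔ Nat.count (PointsRight e) j = c := by
  rw [colSet, Set.mem_ofPred_eq, e.symm_apply_apply, xCoord_eq_count]

omit [Fintype V] in
theorem IsTypeA.mem_rowSet (he : IsTypeA e) {c : ℕ} (j : Fin (m + 1)) :
    e j ∈ rowSet e c ↔ Nat.count (fun j => ¬ PointsRight e j) j = c := by
  rw [rowSet, Set.mem_ofPred_eq, e.symm_apply_apply, he.yCoord_eq_count]

theorem slopeOf_colSet (e : Fin (m + 1) ≃ V) (p : (V → ℝ) × (V → ℝ)) (c : ℕ) :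
    slopeOf (ofCoords p) (QuiverRep.ofSet k (colSet e c)).dimVec =
      levelSum (PointsRight e) m (vertexSeq e p.1) c /
        levelSum (PointsRight e) m (vertexSeq e p.2) c := by
  rw [slopeOf_ofCoords, QuiverRep.dimVec_ofSet, sum_mul_indicator_eq_levelSum (mem_colSet e),
    sum_mul_indicator_eq_levelSum (mem_colSet e)]

theorem IsTypeA.slopeOf_rowSet (he : IsTypeA e) (p : (V → ℝ) × (V → ℝ)) (c : ℕ) :
    slopeOf (ofCoords p) (QuiverRep.ofSet k (rowSet e c)).dimVec =
      levelSum (fun j => ¬ PointsRight e j) m (vertexSeq e p.1) c /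
        levelSum (fun j => ¬ PointsRight e j) m (vertexSeq e p.2) c := by
  rw [slopeOf_ofCoords, QuiverRep.dimVec_ofSet, sum_mul_indicator_eq_levelSum he.mem_rowSet,
    sum_mul_indicator_eq_levelSum he.mem_rowSet]

theorem IsTypeA.latticeIneqs_iff (he : IsTypeA e) (p : (V → ℝ) × (V → ℝ)) :
    ((∀ c < xCoord e (Fin.last m), ColIneq k e (ofCoords p) c) ∧
      ∀ c < yCoord e (Fin.last m), RowIneq k e (ofCoords p) c) ↔ LatticeIneqs e p := by
  have hneg : ∀ c, levelSum (fun j => ¬ PointsRight e j) m (fun j => - vertexSeq e p.1 j) c =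
      - levelSum (fun j => ¬ PointsRight e j) m (vertexSeq e p.1) c := fun c => by simp [levelSum]
  simp only [ColIneq, RowIneq, slopeOf_colSet, he.slopeOf_rowSet, xCoord_eq_count,
    he.yCoord_eq_count, Fin.val_last, gt_iff_lt, LatticeIneqs, LevelsDecrease, hneg, neg_div,
    neg_lt_neg_iff]

theorem IsTypeA.isStable_of_latticeIneqs (he : IsTypeA e) {p : (V → ℝ) × (V → ℝ)}
    (hp : ∀ z, 0 < p.2 z) (h : LatticeIneqs e p) {M : QuiverRep k V} (hM : M.IsIndecomposable) :
    M.IsStable (ofCoords p) := by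
  obtain ⟨a, b, hab, hdim, hinj⟩ := hM.exists_interval he
  intro N hN0 hN1
  have ham := a.2
  have hbm := b.2
  have hab' : (a : ℕ) ≤ b := hab
  have hle : ∀ z, finrank k (N.space z) ≤ finrank k (M.space z) := fun z =>
    Submodule.finrank_le _
  set g : ℕ → ℝ := vertexSeq e fun z => (finrank k (N.space z) : ℝ) with hg
  have restrict : ∀ f F : ℕ → ℝ, (∀ j : Fin (m + 1), F j = if a ≤ j ∧ j ≤ b then f j else 0) →
      ∑ j ∈ Finset.range (m + 1), F j = ∑ j ∈ Finset.Ico (a : ℕ) (b + 1), f j := by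
    intro f F hF
    rw [← Finset.sum_subset (s₁ := Finset.Ico (a : ℕ) (b + 1)) (f := F)]
    · apply Finset.sum_congr rfl
      intro j hj
      rw [Finset.mem_Ico] at hj
      have := hF ⟨j, by omega⟩
      simp only [Fin.le_def] at this
      rw [this, if_pos ⟨hj.1, by omega⟩]
    · intro j hj
      rw [Finset.mem_Ico] at hj
      rw [Finset.mem_range]
      omega
    · intro j hj hj'
      rw [Finset.mem_range] at hj
      rw [Finset.mem_Ico] at hj'
      have := hF ⟨j, hj⟩
      simp only [Fin.le_def] at this
      rw [this, if_neg (by omega)]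
  have hMsum : ∀ f : V → ℝ, ∑ z, f z * (M.dimVec z : ℝ) =
      ∑ j ∈ Finset.Ico (a : ℕ) (b + 1), vertexSeq e f j := by
    intro f
    rw [sum_eq_sum_vertexSeq e]
    apply restrict
    intro j
    simp only [vertexSeq_val, QuiverRep.dimVec, hdim]
    split_ifs <;> simp
  have hNsum : ∀ f : V → ℝ, ∑ z, f z * (N.toRep.dimVec z : ℝ) =
      ∑ j ∈ Finset.Ico (a : ℕ) (b + 1), g j * vertexSeq e f j := by
    intro f
    rw [sum_eq_sum_vertexSeq e]
    apply restrict
    intro j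
    simp only [vertexSeq_val, hg]
    change f (e j) * (((finrank k (N.space (e j)) : ℕ) : ℤ) : ℝ) = _
    split_ifs with hj
    · push_cast; ring
    · have := hle (e j)
      rw [hdim, if_neg hj] at this
      simp [Nat.le_zero.1 this]
  have harrow : ∀ j l : Fin (m + 1), a ≤ j → j ≤ b → a ≤ l → l ≤ b → (e j ⟶ e l) →
      g j ≤ g l := by
    intro j l h1 h2 h3 h4 α
    simp only [hg, vertexSeq_val, Nat.cast_le]
    exact N.finrank_le_of_injective α (hinj j l h1 h2 h3 h4 α)
  rw [slopeOf_ofCoords, slopeOf_ofCoords, hMsum, hMsum, hNsum, hNsum]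
  refine slope_lt_of_closed (vertexSeq_pos hp) h.1 h.2 hab' (by omega) ?_ ?_ ?_ ?_
  · intro j hj
    rw [hg, vertexSeq]
    split_ifs <;> positivity
  · intro j hj hU
    rw [Finset.mem_Ico] at hj
    obtain ⟨hjm, ⟨α⟩⟩ := hU
    exact harrow (⟨j, hjm⟩ : Fin m).castSucc (⟨j, hjm⟩ : Fin m).succ (by simp [Fin.le_def]; omega)
      (by simp [Fin.le_def]; omega) (by simp [Fin.le_def]; omega) (by simp [Fin.le_def]; omega) α
  · intro j hj hU
    rw [Finset.mem_Ico] at hj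
    have hjm : j < m := by omega
    obtain ⟨α⟩ := (he.not_pointsRight_iff (j := ⟨j, hjm⟩)).1 hU
    exact harrow (⟨j, hjm⟩ : Fin m).succ (⟨j, hjm⟩ : Fin m).castSucc (by simp [Fin.le_def]; omega)
      (by simp [Fin.le_def]; omega) (by simp [Fin.le_def]; omega) (by simp [Fin.le_def]; omega) α
  -- On the interval the dimensions of `M` are one, so a subrepresentation of constant dimension
  -- there is zero or everything.
  · by_contra! hconst
    have hga : ∀ j : ℕ, (a : ℕ) ≤ j → j ≤ b → g j = g a := by
      intro j hj
      induction j, hj using Nat.le_induction with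
      | base => exact fun _ => rfl
      | succ j hj ih =>
        intro hjb
        rw [← hconst j (Finset.mem_Ico.2 ⟨hj, by omega⟩), ih (by omega)]
    have hall : ∀ j, a ≤ j → j ≤ b → finrank k (N.space (e j)) = finrank k (N.space (e a)) := by
      intro j h1 h2
      have := hga j h1 h2
      simpa [hg] using this
    have ha1 := hle (e a)
    rw [hdim, if_pos ⟨le_rfl, hab⟩] at ha1
    rcases Nat.le_one_iff_eq_zero_or_eq_one.1 ha1 with h0 | h1
    · apply hN0
      intro z
      obtain ⟨j, rfl⟩ := e.surjective z
      rw [← Submodule.finrank_eq_zero (R := k)]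
      by_cases hj : a ≤ j ∧ j ≤ b
      · rw [hall j hj.1 hj.2, h0]
      · have := hle (e j)
        rw [hdim, if_neg hj] at this
        omega
    · apply hN1
      intro z
      obtain ⟨j, rfl⟩ := e.surjective z
      apply Submodule.eq_top_of_finrank_eq
      rw [hdim]
      split_ifs with hj
      · rw [hall j hj.1 hj.2, h1]
      · have := hle (e j)
        rw [hdim, if_neg hj] at this
        omega

omit [Fintype V] in
-- The dimensions of both summands can only grow along arrows within `S`, while their sum is
-- constantly one there; hence each is constant on the interval, and one of them is zero.
theorem IsTypeA.isIndecomposable_ofSet (he : IsTypeA e) {S : Set V} (hne : S.Nonempty)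
    (hS : ∀ i j l, i ≤ j → j ≤ l → e i ∈ S → e l ∈ S → e j ∈ S) :
    (QuiverRep.ofSet k S).IsIndecomposable := by
  classical
  have hdim := QuiverRep.finrank_ofSet (k := k) S
  refine ⟨?_, fun N N' hc => ?_⟩
  · obtain ⟨z, hz⟩ := hne
    refine ⟨z, nontrivial_of_finrank_pos (R := k) ?_⟩
    rw [hdim, if_pos hz]
    exact one_pos
  have hadd : ∀ z, finrank k (N.space z) + finrank k (N'.space z) = if z ∈ S then 1 else 0 :=
    fun z => by rw [← hdim, Submodule.finrank_add_eq_of_isCompl (hc z)]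
  have harrow : ∀ a b, a ∈ S → b ∈ S → (a ⟶ b) →
      finrank k (N.space a) = finrank k (N.space b) := by
    intro a b ha hb α
    have h1 := N.finrank_le_of_injective α (QuiverRep.injective_map_ofSet ha hb α)
    have h2 := N'.finrank_le_of_injective α (QuiverRep.injective_map_ofSet ha hb α)
    have h3 := hadd a
    have h4 := hadd b
    rw [if_pos ha] at h3
    rw [if_pos hb] at h4
    omega
  have hconst : ∀ i l : Fin (m + 1), i ≤ l → e i ∈ S → e l ∈ S →
      finrank k (N.space (e i)) = finrank k (N.space (e l)) := by
    intro i l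
    induction l using Fin.induction with
    | zero =>
      intro h _ _
      rw [Fin.le_zero_iff.1 h]
    | succ l ih =>
      intro h hi hl
      rcases h.eq_or_lt with rfl | hlt
      · rfl
      have hil : i ≤ l.castSucc := Fin.le_castSucc_iff.2 hlt
      have hl' := hS i l.castSucc l.succ hil Fin.castSucc_lt_succ.le hi hl
      rw [ih hil hi hl']
      rcases he.right_or_left l with ⟨α, -, -⟩ | ⟨α, -, -⟩
      · exact harrow _ _ hl' hl α
      · exact (harrow _ _ hl hl' α).symm
  obtain ⟨z₀, hz₀⟩ := hne
  have hall : ∀ z ∈ S, finrank k (N.space z) = finrank k (N.space z₀) := by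
    intro z hz
    obtain ⟨i, rfl⟩ := e.surjective z
    obtain ⟨l, rfl⟩ := e.surjective z₀
    rcases le_total i l with h | h
    · exact hconst i l h hz hz₀
    · exact (hconst l i h hz₀ hz).symm
  have h0 := hadd z₀
  rw [if_pos hz₀] at h0
  rcases Nat.eq_zero_or_pos (finrank k (N.space z₀)) with h | h
  · left
    intro z
    rw [← Submodule.finrank_eq_zero (R := k)]
    have h1 := hadd z
    split_ifs at h1 with hz
    · rw [hall z hz, h]
    · omega
  · right
    intro z
    rw [← Submodule.finrank_eq_zero (R := k)]
    have h1 := hadd z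
    split_ifs at h1 with hz
    · have := hall z hz
      omega
    · omega

/-! ### Necessity of the inequalities. -/

/-- For a total stability condition, a sub-interval module has smaller slope than its quotient. -/
theorem IsTypeA.slopeOf_lt_of_totalStability (he : IsTypeA e) {p : (V → ℝ) × (V → ℝ)}
    (hp : ofCoords p ∈ TotalStability k V) {S T : Set V} (hSne : S.Nonempty) (hTne : T.Nonempty)
    (hdisj : Disjoint S T) (hno : ∀ a ∈ S, ∀ b ∈ T, IsEmpty (a ⟶ b))
    (hST : ∀ i j l, i ≤ j → j ≤ l → e i ∈ S ∪ T → e l ∈ S ∪ T → e j ∈ S ∪ T) :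
    slopeOf (ofCoords p) (QuiverRep.ofSet k S).dimVec <
      slopeOf (ofCoords p) (QuiverRep.ofSet k T).dimVec := by
  classical
  have hdim := QuiverRep.finrank_ofSet (k := k) (S ∪ T)
  let N : (QuiverRep.ofSet k (S ∪ T)).Subrep :=
    { space := fun z => if z ∈ S then ⊤ else ⊥
      map_mem := by
        intro a b α x hx
        by_cases ha : a ∈ S
        · by_cases hb : b ∈ S
          · rw [if_pos hb]
            trivial
          · have hb' : b ∉ S ∪ T := fun h =>
              h.elim hb fun hT => (hno a ha b hT).false α
            have h0 : (QuiverRep.ofSet k (S ∪ T)).map α = 0 := dif_neg fun h => hb' h.2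
            rw [h0]
            exact zero_mem _
        · rw [if_neg ha] at hx
          rw [(Submodule.mem_bot k).1 hx, map_zero]
          exact zero_mem _ }
  have hNdim : ∀ z, finrank k (N.space z) = if z ∈ S then 1 else 0 := by
    intro z
    change finrank k ((if z ∈ S then ⊤ else ⊥ : Submodule k _)) = _
    by_cases h : z ∈ S
    · rw [if_pos h, if_pos h, finrank_top, hdim, if_pos (show z ∈ S ∪ T from Or.inl h)]
    · rw [if_neg h, if_neg h, finrank_bot]
  have hN : N.toRep.dimVec = (QuiverRep.ofSet k S).dimVec := by
    ext z
    rw [QuiverRep.dimVec_ofSet]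
    change ((finrank k (N.space z) : ℕ) : ℤ) = _
    rw [hNdim]
    split_ifs with h <;> simp [h]
  have hM : (QuiverRep.ofSet k (S ∪ T)).dimVec =
      (QuiverRep.ofSet k S).dimVec + (QuiverRep.ofSet k T).dimVec := by
    ext z
    simp only [QuiverRep.dimVec_ofSet, Pi.add_apply, Set.mem_union]
    have : z ∈ S → z ∉ T := fun h => Set.disjoint_left.1 hdisj h
    by_cases h1 : z ∈ S <;> by_cases h2 : z ∈ T <;> simp_all
  have hlt := hp.2 _ (he.isIndecomposable_ofSet (k := k) (hSne.mono Set.subset_union_left) hST) N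
    (by
      obtain ⟨z, hz⟩ := hSne
      intro h
      have h1 := hNdim z
      rw [h z, if_pos hz, finrank_bot] at h1
      omega)
    (by
      obtain ⟨z, hz⟩ := hTne
      intro h
      have h1 := hNdim z
      rw [h z, finrank_top, hdim, if_pos (show z ∈ S ∪ T from Or.inr hz),
        if_neg (Set.disjoint_right.1 hdisj hz)] at h1
      omega)
  have him : ∀ S : Set V, S.Nonempty →
      0 < (ofCoords p (QuiverRep.ofSet k S).dimVec).im := by
    rintro S ⟨z, hz⟩
    refine hp.1 _ ⟨z, nontrivial_of_finrank_pos (R := k) ?_⟩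
    rw [QuiverRep.finrank_ofSet, if_pos hz]
    exact one_pos
  have hS0 := him S hSne
  have hT0 := him T hTne
  -- The slope of the union is the mediant of the slopes of `S` and `T`, so being below it is the
  -- same as being below the slope of `T`.
  rw [hN, hM, slopeOf, slopeOf, map_add, Complex.add_re, Complex.add_im,
    div_lt_div_iff₀ hS0 (by linarith)] at hlt
  rw [slopeOf, slopeOf, div_lt_div_iff₀ hS0 hT0]
  linarith

/-- Any arrow between X_c and X_{c+1} runs towards X_{c+1}, and any arrow between Y_c and Y_{c+1}
towards Y_c; this decides which of the two is the subrepresentation of the module on their union. -/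
theorem IsTypeA.latticeIneqs_of_totalStability (he : IsTypeA e) {p : (V → ℝ) × (V → ℝ)}
    (hp : ofCoords p ∈ TotalStability k V) :
    (∀ c < xCoord e (Fin.last m), ColIneq k e (ofCoords p) c) ∧
      ∀ c < yCoord e (Fin.last m), RowIneq k e (ofCoords p) c := by
  have hmono : ∀ (U : ℕ → Prop) [DecidablePred U] (i l : Fin (m + 1)), i ≤ l →
    Nat.count U i ≤ Nat.count U l := fun U _ i l h => Nat.count_monotone U h
  constructor
  · intro c hc
    rw [xCoord_eq_count, Fin.val_last] at hc
    have hne : ∀ c ≤ Nat.count (PointsRight e) m, (colSet e c).Nonempty := fun c hc => by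
      obtain ⟨j, hj, h⟩ := exists_count_eq (PointsRight e) m c hc
      exact ⟨e ⟨j, by omega⟩, (mem_colSet e _).2 h⟩
    refine he.slopeOf_lt_of_totalStability hp (hne _ hc) (hne _ hc.le) ?_ ?_ ?_
    · rw [Set.disjoint_left]
      intro z h1 h2
      obtain ⟨j, rfl⟩ := e.surjective z
      rw [mem_colSet] at h1 h2
      omega
    · refine fun a ha b hb => ⟨fun α => ?_⟩
      obtain ⟨i, ⟨rfl, rfl⟩ | ⟨rfl, rfl⟩⟩ := he.exists_of_arrow α <;>
        rw [mem_colSet, Fin.val_castSucc, Fin.val_succ, Nat.count_succ] at *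
      · omega
      · rw [if_neg (he.not_pointsRight_iff.2 ⟨α⟩)] at ha
        omega
    · intro i j l hij hjl hi hl
      have h1 := hmono (PointsRight e) i j hij
      have h2 := hmono (PointsRight e) j l hjl
      simp only [Set.mem_union, mem_colSet] at hi hl ⊢
      omega
  · intro c hc
    rw [he.yCoord_eq_count, Fin.val_last] at hc
    have hne : ∀ c ≤ Nat.count (fun j => ¬ PointsRight e j) m, (rowSet e c).Nonempty :=
      fun c hc => by
        obtain ⟨j, hj, h⟩ := exists_count_eq (fun j => ¬ PointsRight e j) m c hc
        exact ⟨e ⟨j, by omega⟩, (he.mem_rowSet _).2 h⟩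
    refine he.slopeOf_lt_of_totalStability hp (hne _ hc.le) (hne _ hc) ?_ ?_ ?_
    · rw [Set.disjoint_left]
      intro z h1 h2
      obtain ⟨j, rfl⟩ := e.surjective z
      rw [he.mem_rowSet] at h1 h2
      omega
    · refine fun a ha b hb => ⟨fun α => ?_⟩
      obtain ⟨i, ⟨rfl, rfl⟩ | ⟨rfl, rfl⟩⟩ := he.exists_of_arrow α <;>
        rw [he.mem_rowSet, Fin.val_castSucc, Fin.val_succ, Nat.count_succ] at *
      · rw [if_neg (not_not.2 (pointsRight_iff.2 ⟨α⟩))] at hb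
        omega
      · omega
    · intro i j l hij hjl hi hl
      have h1 := hmono (fun j => ¬ PointsRight e j) i j hij
      have h2 := hmono (fun j => ¬ PointsRight e j) j l hjl
      simp only [Set.mem_union, he.mem_rowSet] at hi hl ⊢
      omega

theorem IsTypeA.mem_totalStability_iff (he : IsTypeA e) {p : (V → ℝ) × (V → ℝ)} :
    ofCoords p ∈ TotalStability k V ↔ (∀ z, 0 < p.2 z) ∧ LatticeIneqs e p := by
  constructor
  · exact fun h => ⟨isCentralCharge_ofCoords.1 h.1,
      (he.latticeIneqs_iff (k := k) p).1 (he.latticeIneqs_of_totalStability h)⟩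
  · exact fun h => ⟨isCentralCharge_ofCoords.2 h.1,
      fun M hM => he.isStable_of_latticeIneqs h.1 h.2 hM⟩

/-! ### Openness, and independence of the inequalities. -/

theorem isOpen_levelsDecrease {X : Type*} [TopologicalSpace X] (U : ℕ → Prop) [DecidablePred U]
    (m : ℕ) {f g : X → ℕ → ℝ} (hf : ∀ j, Continuous fun x => f x j)
    (hg : ∀ j, Continuous fun x => g x j) :
    IsOpen {x | (∀ j ≤ m, 0 < g x j) ∧ LevelsDecrease U m (f x) (g x)} := by
  have hset : {x | (∀ j ≤ m, 0 < g x j) ∧ LevelsDecrease U m (f x) (g x)} =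
      (⋂ j ∈ Finset.range (m + 1), {x | 0 < g x j}) ∩
      ⋂ c ∈ Finset.range (Nat.count U m), {x | levelSum U m (f x) (c + 1) * levelSum U m (g x) c <
        levelSum U m (f x) c * levelSum U m (g x) (c + 1)} := by
    ext x
    simp only [Set.mem_ofPred_eq, Set.mem_inter_iff, Set.mem_iInter, Finset.mem_range,
      Nat.lt_succ_iff]
    -- Positivity of the denominators turns the slope inequalities into strict polynomial ones.
    refine and_congr_right fun hx => forall₂_congr fun c hc => ?_
    exact div_lt_div_iff₀ (levelSum_pos hx (by omega)) (levelSum_pos hx (by omega))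
  have hcont : ∀ {f : X → ℕ → ℝ}, (∀ j, Continuous fun x => f x j) →
      ∀ c, Continuous fun x => levelSum U m (f x) c := fun hf c =>
    continuous_finsetSum _ fun j _ => hf j
  rw [hset]
  exact (isOpen_biInter_finset fun j _ => isOpen_lt continuous_const (hg j)).inter
    (isOpen_biInter_finset fun c _ => isOpen_lt ((hcont hf _).mul (hcont hg _))
      ((hcont hf _).mul (hcont hg _)))

theorem IsTypeA.isOpen_totalStability (he : IsTypeA e) :
    IsOpen {p : (V → ℝ) × (V → ℝ) | ofCoords p ∈ TotalStability k V} := by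
  have hc : ∀ {F : (V → ℝ) × (V → ℝ) → V → ℝ}, Continuous F →
      ∀ j, Continuous fun p => vertexSeq e (F p) j := by
    intro F hF j
    unfold vertexSeq
    split_ifs
    · exact (continuous_apply _).comp hF
    · exact continuous_const
  convert (isOpen_levelsDecrease (PointsRight e) m (hc continuous_fst) (hc continuous_snd)).inter
    (isOpen_levelsDecrease (fun j => ¬ PointsRight e j) m (fun j => (hc continuous_fst j).neg)
      (hc continuous_snd)) using 1
  ext p
  simp only [Set.mem_ofPred_eq, he.mem_totalStability_iff, LatticeIneqs, Set.mem_inter_iff]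
  have hpos : (∀ z, 0 < p.2 z) ↔ ∀ j ≤ m, 0 < vertexSeq e p.2 j := by
    refine ⟨vertexSeq_pos, fun h z => ?_⟩
    obtain ⟨j, rfl⟩ := e.surjective z
    simpa using h j (by omega)
  rw [hpos]
  tauto

/-- With all r equal to 1, slopes are averages of w over levels. The shifts `σ` and `τ` are
harmless, since only slopes within one family are compared. -/
theorem IsTypeA.exists_slopes (he : IsTypeA e) (k : Type u) [Field k] (s t : ℕ → ℝ) :
    ∃ (p : (V → ℝ) × (V → ℝ)) (σ τ : ℝ), (∀ z, 0 < p.2 z) ∧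
      (∀ c ≤ xCoord e (Fin.last m),
        slopeOf (ofCoords p) (QuiverRep.ofSet k (colSet e c)).dimVec = s c - σ) ∧
      ∀ c ≤ yCoord e (Fin.last m),
        slopeOf (ofCoords p) (QuiverRep.ofSet k (rowSet e c)).dimVec = t c - τ := by
  obtain ⟨w, σ, τ, h1, h2⟩ := exists_weights (PointsRight e) m s t
  have hcongr : ∀ (U : ℕ → Prop) [DecidablePred U] (c : ℕ) (f : ℕ → ℝ),
      levelSum U m (vertexSeq e fun z => f (e.symm z)) c = levelSum U m f c := by
    intro U _ c f
    refine Finset.sum_congr rfl fun j hj => ?_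
    rw [Finset.mem_filter, Finset.mem_range] at hj
    simp [vertexSeq, hj.1]
  refine ⟨(fun z => w (e.symm z), fun _ => 1), σ, τ, fun _ => one_pos, fun c hc => ?_,
    fun c hc => ?_⟩
  · rw [xCoord_eq_count, Fin.val_last] at hc
    rw [slopeOf_colSet, hcongr _ c w, hcongr _ c fun _ => 1, h1 c hc,
      mul_div_cancel_right₀ _ (levelSum_pos (fun _ _ => one_pos) hc).ne']
  · rw [he.yCoord_eq_count, Fin.val_last] at hc
    rw [he.slopeOf_rowSet, hcongr _ c w, hcongr _ c fun _ => 1, h2 c hc,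
      mul_div_cancel_right₀ _ (levelSum_pos (fun _ _ => one_pos) hc).ne']

end TypeA

/-- A sequence that increases at every step except at the step from `c₀`. -/
def stallingSeq (c₀ c : ℕ) : ℝ := if c ≤ c₀ then c else (c : ℝ) - 1

theorem stallingSeq_lt {c₀ c : ℕ} (h : c ≠ c₀) : stallingSeq c₀ c < stallingSeq c₀ (c + 1) := by
  unfold stallingSeq
  split_ifs with h1 h2 h2 <;> first | omega | (push_cast; linarith)

theorem stallingSeq_succ_self (c₀ : ℕ) : stallingSeq c₀ (c₀ + 1) = stallingSeq c₀ c₀ := by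
  simp [stallingSeq]

end

/-- The quiver `V` has `n = m + 1` vertices `e 0, …, e m`. The conjuncts say: there are `n - 1`
inequalities; they characterise the total stability conditions among all central charges; in the
coordinates `(w, r) ∈ ℝ^{Q₀} × ℝ_{>0}^{Q₀}` the set `TS(Q)` is open; and a subfamily of the
inequalities (the column inequalities in `A` and the row inequalities in `B`) cuts it out
only if it is the whole family. -/
theorem theorem1p3 {k : Type*} [Field k] [IsAlgClosed k]
    {V : Type*} [Fintype V] [Quiver V] {m : ℕ}
    (e : Fin (m + 1) ≃ V) (he : IsTypeA e) :
    xCoord e (Fin.last m) + yCoord e (Fin.last m) = m ∧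
    (∀ Z : (V → ℤ) →+ ℂ, IsCentralCharge k Z →
      (Z ∈ TotalStability k V ↔
        (∀ c < xCoord e (Fin.last m), ColIneq k e Z c) ∧
        (∀ c < yCoord e (Fin.last m), RowIneq k e Z c))) ∧
    IsOpen {p : (V → ℝ) × (V → ℝ) | ofCoords p ∈ TotalStability k V} ∧
    (∀ (A : Set (Fin (xCoord e (Fin.last m)))) (B : Set (Fin (yCoord e (Fin.last m)))),
      {p : (V → ℝ) × (V → ℝ) | (∀ z, 0 < p.2 z) ∧
          (∀ c ∈ A, ColIneq k e (ofCoords p) c) ∧ (∀ c ∈ B, RowIneq k e (ofCoords p) c)} =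
        {p : (V → ℝ) × (V → ℝ) | ofCoords p ∈ TotalStability k V} →
      A = Set.univ ∧ B = Set.univ) := by
  refine ⟨by simpa using he.xCoord_add_yCoord (Fin.last m), ?_, he.isOpen_totalStability, ?_⟩
  · intro Z hZ
    obtain ⟨p, rfl⟩ := exists_eq_ofCoords Z
    rw [he.mem_totalStability_iff, he.latticeIneqs_iff]
    exact and_iff_right (isCentralCharge_ofCoords.1 hZ)
  · intro A B hAB
    have hsub : ∀ p : (V → ℝ) × (V → ℝ), (∀ z, 0 < p.2 z) →
        (∀ c ∈ A, ColIneq k e (ofCoords p) c) → (∀ c ∈ B, RowIneq k e (ofCoords p) c) →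
        (∀ c < xCoord e (Fin.last m), ColIneq k e (ofCoords p) c) ∧
          ∀ c < yCoord e (Fin.last m), RowIneq k e (ofCoords p) c := by
      intro p hp hA hB
      have hmem := Set.ext_iff.1 hAB p
      exact he.latticeIneqs_of_totalStability (hmem.1 ⟨hp, hA, hB⟩)
    constructor
    · refine Set.eq_univ_of_forall fun c₀ => ?_
      by_contra hc₀
      -- Columns tie exactly at the omitted index `c₀` and decrease strictly elsewhere, while all
      -- rows increase: this point meets every retained inequality but is not totally stable.
      obtain ⟨p, σ, τ, hp, hs, ht⟩ :=
        he.exists_slopes k (fun c => -stallingSeq c₀ c) (fun c => (c : ℝ))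
      have h := (hsub p hp (fun c hc => ?_) (fun c _ => ?_)).1 c₀ c₀.2
      · rw [ColIneq, hs _ c₀.2.le, hs _ c₀.2, stallingSeq_succ_self] at h
        exact lt_irrefl _ h
      · rw [ColIneq, hs _ c.2.le, hs _ c.2]
        have := stallingSeq_lt (c₀ := c₀) (c := c) fun h => hc₀ (Fin.ext h ▸ hc)
        linarith
      · rw [RowIneq, ht _ c.2.le, ht _ c.2]
        push_cast
        linarith
    · refine Set.eq_univ_of_forall fun c₀ => ?_
      by_contra hc₀
      obtain ⟨p, σ, τ, hp, hs, ht⟩ :=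
        he.exists_slopes k (fun c => -(c : ℝ)) (stallingSeq c₀)
      have h := (hsub p hp (fun c _ => ?_) (fun c hc => ?_)).2 c₀ c₀.2
      · rw [RowIneq, ht _ c₀.2.le, ht _ c₀.2, stallingSeq_succ_self] at h
        exact lt_irrefl _ h
      · rw [ColIneq, hs _ c.2.le, hs _ c.2]
        push_cast
        linarith
      · rw [RowIneq, ht _ c.2.le, ht _ c.2]
        have := stallingSeq_lt (c₀ := c₀) (c := c) fun h => hc₀ (Fin.ext h ▸ hc)
        linarith
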